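/- An entire function $E$ is of Hermite--Biehler class if $|E(\bar z)|<|E(z)|$ whenever $\operatorname{Im} z>0$. Write $E^*(z)=\overline{E(\bar z)}$. The de Branges space $\mathcal H(E)$ consists of the entire functions $f$ with $\|f\|_E^2=\int_{\mathbb R}|f(t)/E(t)|^2\,dt<\infty$ such that $f/E$ and $f^*/E$ are of bounded type (quotients of bounded analytic functions) and of nonpositive mean type $\limsup_{y\to+\infty}y^{-1}\log|\cdot(iy)|$ in the upper half-plane, with inner product $\langle f,g\rangle_E=\int_{\mathbb R}f(t)\overline{g(t)}|E(t)|^{-2}\,dt$. Its reproducing kernel is \[K_E(w,z)=\frac{\overline{E(w)}E(z)-E(\bar w)E^*(z)}{2\pi i(\bar w-z)},\] extended continuously to $z=\bar w$. A phase function of $E$ is a continuous, strictly increasing $\varphi_E:\mathbb R\to\mathbb R$ such that $E(x)e^{i\varphi_E(x)}\in\mathbb R$ for all $x\in\mathbb R$ (for instance, such that $E(x)=|E(x)|e^{-i\varphi_E(x)}$). A family $\{u_n\}$ in $\mathcal H(E)$ is a Parseval frame for $\mathcal H(E)$ if $\sum_n|\langle f,u_n\rangle_E|^2=\|f\|_E^2$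 for all $f\in\mathcal H(E)$. Theorem. Let $E,F$ be of Hermite--Biehler class, let $\varphi_{EF}$ be a phase function of $EF$, let $\alpha\in[0,\pi)$, let $J\subseteq\mathbb Z$ (for example $J=\mathbb Z$), and let $\{\lambda_n\}_{n\in J}\subset\mathbb R$ satisfy $\varphi_{EF}(\lambda_n)=n\pi+\alpha$ for all $n\in J$. Suppose that $\{K_{EF}(\lambda_n,\cdot)\}_{n\in J}$ is complete in $\mathcal H(EF)$, i.e. its linear span is dense. Then \[\left\{\frac{\overline{F(\lambda_n)}\,K_E(\lambda_n,\cdot)}{\sqrt{K_{EF}(\lambda_n,\lambda_n)}}\right\}_{n\in J}\] is a Parseval frame for $\mathcal H(E)$, and for every $f\in\mathcal H(E)$ \[f(z)=\sum_{n\in J}f(\lambda_n)\frac{|F(\lambda_n)|^2K_E(\lambda_n,z)}{K_{EF}(\lambda_n,\lambda_n)},\] where the series converges unconditionally in the norm of $\mathcal H(E)$ and at every $z\in\mathbb C$. Likewise \[\left\{\frac{E(\lambda_n)\,K_F(\lambda_n,\cdot)}{\sqrt{K_{EF}(\lambda_n,\lambda_n)}}\right\}_{n\in J}\] is a Parseval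 frame for $\mathcal H(F)$, and for every $g\in\mathcal H(F)$ \[g(z)=\sum_{n\in J}g(\lambda_n)\frac{|E(\lambda_n)|^2K_F(\lambda_n,z)}{K_{EF}(\lambda_n,\lambda_n)},\] with unconditional convergence in the norm of $\mathcal H(F)$ and at every $z\in\mathbb C$. -/

import Mathlib

open Complex MeasureTheory Filter Topology
open scoped ComplexConjugate

namespace DeBranges

noncomputable section

/-- The open upper half-plane, as a subset of `ℂ`. -/
def upperHalf : Set ℂ := {z | 0 < z.im}

/-- The Hermite-Biehler class: entire functions with `|E(z̄)| < |E(z)|` on the open upper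
half-plane. -/
structure IsHermiteBiehler (E : ℂ → ℂ) : Prop where
  entire : Differentiable ℂ E
  norm_lt : ∀ z ∈ upperHalf, ‖E (conj z)‖ < ‖E z‖

/-- `f*(z) = conj (f (z̄))`. -/
def starFn (f : ℂ → ℂ) (z : ℂ) : ℂ := conj (f (conj z))

/-- `f` is bounded and analytic in the open upper half-plane. -/
def IsBoundedAnalytic (f : ℂ → ℂ) : Prop :=
  DifferentiableOn ℂ f upperHalf ∧ ∃ C : ℝ, ∀ z ∈ upperHalf, ‖f z‖ ≤ C

/-- `f` is analytic and of bounded type in the open upper half-plane: it is the quotient `p / q`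
of two bounded analytic functions, where `q` is not identically zero. -/
def IsBoundedType (f : ℂ → ℂ) : Prop :=
  DifferentiableOn ℂ f upperHalf ∧
    ∃ p q : ℂ → ℂ, IsBoundedAnalytic p ∧ IsBoundedAnalytic q ∧
      (∃ z ∈ upperHalf, q z ≠ 0) ∧ ∀ z ∈ upperHalf, f z * q z = p z

/-- The mean type `limsup_{y → +∞} log |f(iy)| / y`, as an extended real (with `log 0 = -∞`). -/
def meanType (f : ℂ → ℂ) : EReal :=
  limsup (fun y : ℝ => ENNReal.log ‖f (I * (y : ℂ))‖ₑ / (y : EReal)) atTop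

/-- The de Branges space `H(E)`: the entire functions `f` with `∫ |f/E|² < ∞` on the real line,
such that `f/E` and `f*/E` are of bounded type and of nonpositive mean type in the upper
half-plane. -/
structure MemH (E f : ℂ → ℂ) : Prop where
  entire : Differentiable ℂ f
  sq_integrable : Integrable (fun t : ℝ => ‖f t / E t‖ ^ 2)
  boundedType : IsBoundedType (fun z => f z / E z)
  meanType_le : meanType (fun z => f z / E z) ≤ 0
  boundedType_star : IsBoundedType (fun z => starFn f z / E z)
  meanType_star_le : meanType (fun z => starFn f z / E z) ≤ 0

/-- The inner product of `H(E)`, linear in the first argument. -/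
def innerH (E f g : ℂ → ℂ) : ℂ := ∫ t : ℝ, f t * conj (g t) / ((‖E t‖ ^ 2 : ℝ) : ℂ)

/-- The norm of `H(E)`. -/
def normH (E f : ℂ → ℂ) : ℝ := Real.sqrt (∫ t : ℝ, ‖f t / E t‖ ^ 2)

/-- The reproducing kernel
`K_E(w, z) = (conj E(w) E(z) - E(w̄) E*(z)) / (2πi (w̄ - z))`. The numerator, as a function of `z`,
vanishes at `z = w̄`; there the value is the limit, i.e. minus the derivative of the numerator
divided by `2πi`. -/
def kernel (E : ℂ → ℂ) (w z : ℂ) : ℂ :=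
  if z = conj w then
    -deriv (fun ζ => conj (E w) * E ζ - E (conj w) * starFn E ζ) (conj w) / (2 * Real.pi * I)
  else
    (conj (E w) * E z - E (conj w) * starFn E z) / (2 * Real.pi * I * (conj w - z))

/-- `φ` is a phase function of `E`: continuous, strictly increasing, and `E(x) e^{iφ(x)}` is real
for every real `x`. In particular this holds if `E(x) = |E(x)| e^{-iφ(x)}`; asking only for a real
value also covers functions `E` with real zeros. -/
structure IsPhaseFunction (E : ℂ → ℂ) (φ : ℝ → ℝ) : Prop where
  continuous : Continuous φ
  strictMono : StrictMono φ
  real : ∀ x : ℝ, (E x * exp (I * φ x)).im = 0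

/-- The family `u` of elements of `H(E)` is complete in `H(E)`: every element of `H(E)` is
approximated in norm by finite linear combinations. -/
def IsCompleteIn {ι : Type*} (E : ℂ → ℂ) (u : ι → ℂ → ℂ) : Prop :=
  ∀ h, MemH E h → ∀ ε > 0, ∃ (s : Finset ι) (c : ι → ℂ),
    normH E (fun z => h z - ∑ n ∈ s, c n * u n z) < ε

/-- `u` is a Parseval frame for `H(E)`: a family in `H(E)` with
`∑ |⟨f, u n⟩|² = ‖f‖²` for all `f ∈ H(E)`. -/
def IsParsevalFrame {ι : Type*} (E : ℂ → ℂ) (u : ι → ℂ → ℂ) : Prop :=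
  (∀ n, MemH E (u n)) ∧
    ∀ f, MemH E f → HasSum (fun n => ‖innerH E f (u n)‖ ^ 2) (normH E f ^ 2)

/-- The series `∑ u n` converges unconditionally to `f`, both in the norm of `H(E)` and
pointwise on `ℂ`. -/
def IsExpansion {ι : Type*} (E f : ℂ → ℂ) (u : ι → ℂ → ℂ) : Prop :=
  Tendsto (fun s : Finset ι => normH E (fun z => f z - ∑ n ∈ s, u n z)) atTop (𝓝 0) ∧
    ∀ z, HasSum (fun n => u n z) (f z)

end

end DeBranges

/-!
Division by `E` embeds `H(E)` isometrically into `L²(ℝ)`, and `f ∈ H(E)` has the same image as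
`F f ∈ H(EF)`, so `H(E)` becomes a subspace of `H(EF)`. Since
`⟨F f, K_EF(λ, ·)⟩ = F(λ) f(λ)`, the orthogonal projection of `K_EF(λ, ·)` onto this subspace is the
image of `conj F(λ) K_E(λ, ·)`. Equality of phases modulo `π` makes the kernels `K_EF(λ_n, ·)`
orthogonal, completeness makes them an orthogonal basis, and the projection of an orthonormal basis
onto a subspace is a Parseval frame for that subspace.

The analytic content is the reproducing property at real points. For `f ∈ H(E)` the quotient
`G = f / E` is of bounded type with nonpositive mean type, so `log ‖G‖` is bounded by the Poisson
integral of its boundary values, and Jensen's inequality gives the same for `‖G‖ ^ 2`. Hence `G`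
and `f* / E` lie in the Hardy space `H²`, where Cauchy's theorem evaluates the inner product with
the kernel.
-/

namespace DeBranges

noncomputable section

open Real (posLog)
open Submodule
open Metric (ball closedBall sphere)

section OrthogonalExpansion

variable {ι 𝕜 V : Type*} [RCLike 𝕜] [NormedAddCommGroup V] [InnerProductSpace 𝕜 V]

theorem norm_sub_le_norm_sub_of_inner_eq_zero {x y z : V} (h : inner 𝕜 (x - y) (y - z) = 0) :
    ‖x - y‖ ≤ ‖x - z‖ := by
  have hpyth := norm_add_sq_eq_norm_sq_add_norm_sq_of_inner_eq_zero (x - y) (y - z) h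
  rw [sub_add_sub_cancel] at hpyth
  exact le_of_sq_le_sq (by nlinarith [mul_self_nonneg ‖y - z‖]) (norm_nonneg _)

theorem inner_sub_sum_orthogonal_eq_zero {e : ι → V}
    (he : Pairwise fun m n => inner 𝕜 (e m) (e n) = 0) (x : V) {t : Finset ι} {m : ι}
    (hm : m ∈ t) :
    inner 𝕜 (e m) (x - ∑ n ∈ t, (inner 𝕜 (e n) x / (‖e n‖ ^ 2 : ℝ) : 𝕜) • e n) = 0 := by
  have hself : (inner 𝕜 (e m) x / (‖e m‖ ^ 2 : ℝ) : 𝕜) * inner 𝕜 (e m) (e m) = inner 𝕜 (e m) x := by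
    rw [inner_self_eq_norm_sq_to_K, ← RCLike.ofReal_pow]
    refine div_mul_cancel_of_imp fun h => ?_
    rw [RCLike.ofReal_eq_zero, sq_eq_zero_iff, norm_eq_zero] at h
    rw [h, inner_zero_left]
  rw [inner_sub_right, inner_sum, Finset.sum_eq_single_of_mem m hm fun n _ hn => by
    rw [inner_smul_right, he hn.symm, mul_zero], inner_smul_right, hself, sub_self]

theorem hasSum_orthogonal_expansion {e : ι → V}
    (he : Pairwise fun m n => inner 𝕜 (e m) (e n) = 0) {x : V}
    (hx : x ∈ (span 𝕜 (Set.range e)).topologicalClosure) :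
    HasSum (fun n => (inner 𝕜 (e n) x / (‖e n‖ ^ 2 : ℝ) : 𝕜) • e n) x := by
  classical
  rw [HasSum, SummationFilter.unconditional_filter, Metric.tendsto_atTop]
  intro ε hε
  obtain ⟨y, hy, hxy⟩ := Metric.mem_closure_iff.1 hx ε hε
  obtain ⟨c, rfl⟩ := Finsupp.mem_span_range_iff_exists_finsupp.1 hy
  refine ⟨c.support, fun t ht => lt_of_le_of_lt ?_ hxy⟩
  rw [dist_comm, dist_eq_norm, dist_eq_norm]
  refine norm_sub_le_norm_sub_of_inner_eq_zero (𝕜 := 𝕜) ?_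
  rw [Finsupp.sum_of_support_subset c ht _ fun n _ => zero_smul 𝕜 (e n), ← Finset.sum_sub_distrib,
    inner_sum]
  refine Finset.sum_eq_zero fun n hn => ?_
  rw [← sub_smul, inner_smul_right, inner_eq_zero_symm.1 (inner_sub_sum_orthogonal_eq_zero he x hn),
    mul_zero]

theorem hasSum_sq_norm_inner_div {e : ι → V}
    (he : Pairwise fun m n => inner 𝕜 (e m) (e n) = 0) {x : V}
    (hx : x ∈ (span 𝕜 (Set.range e)).topologicalClosure) :
    HasSum (fun n => ‖inner 𝕜 (e n) x‖ ^ 2 / ‖e n‖ ^ 2) (‖x‖ ^ 2) := by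
  have h := (hasSum_orthogonal_expansion he hx).mapL (innerSL 𝕜 x)
  simp only [innerSL_apply_apply, inner_smul_right, inner_self_eq_norm_sq_to_K] at h
  rw [← RCLike.hasSum_ofReal (𝕜 := 𝕜), RCLike.ofReal_pow]
  refine h.congr_fun fun n => ?_
  rw [RCLike.ofReal_div, RCLike.ofReal_pow, ← RCLike.conj_mul, inner_conj_symm, mul_comm]
  ring

/-- Pythagoras: `∑ a n • v n` is the orthogonal projection of `∑ a n • e n` onto `W ∋ x`. -/
theorem hasSum_smul_of_inner_eq_inner {W : Submodule 𝕜 V} {e v : ι → V} {a : ι → 𝕜} {x : V}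
    (hx : x ∈ W) (hv : ∀ n, v n ∈ W) (hve : ∀ n, ∀ y ∈ W, inner 𝕜 y (v n) = inner 𝕜 y (e n))
    (h : HasSum (fun n => a n • e n) x) : HasSum (fun n => a n • v n) x := by
  rw [HasSum, SummationFilter.unconditional_filter, tendsto_iff_norm_sub_tendsto_zero] at h ⊢
  refine squeeze_zero (fun _ => norm_nonneg _) (fun s => ?_) h
  rw [norm_sub_rev, norm_sub_rev _ x]
  refine norm_sub_le_norm_sub_of_inner_eq_zero (𝕜 := 𝕜) ?_
  have hmem : x - ∑ n ∈ s, a n • v n ∈ W := W.sub_mem hx (W.sum_smul_mem a fun n _ => hv n)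
  rw [← Finset.sum_sub_distrib, inner_sum]
  refine Finset.sum_eq_zero fun n _ => ?_
  rw [inner_sub_right, inner_smul_right, inner_smul_right, hve n _ hmem, sub_self]

end OrthogonalExpansion

section PoissonIntegral

variable {R : ℝ} {w z : ℂ} {u v : ℂ → ℝ}

theorem continuousOn_poissonKernel (hw : w ∈ ball 0 R) :
    ContinuousOn (poissonKernel 0 w) (sphere 0 R) := by
  have h := continuousOn_herglotzRieszKernel_sphere hw
  rw [abs_of_pos (Metric.pos_of_mem_ball hw)] at h
  rw [poissonKernel_eq_re_herglotzRieszKernel]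
  exact continuous_re.comp_continuousOn h

theorem poissonKernel_nonneg (hw : w ∈ ball 0 R) (hz : z ∈ sphere 0 R) :
    0 ≤ poissonKernel 0 w z := by
  rw [mem_ball_zero_iff] at hw
  rw [mem_sphere_zero_iff_norm] at hz
  rw [poissonKernel_def, sub_zero, sub_zero, hz]
  have : ‖w‖ ^ 2 ≤ R ^ 2 := by gcongr
  exact div_nonneg (sub_nonneg.2 this) (sq_nonneg _)

theorem circleIntegrable_poissonKernel_mul (hw : w ∈ ball 0 R)
    (hv : CircleIntegrable v 0 R) : CircleIntegrable (fun z => poissonKernel 0 w z * v z) 0 R :=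
  hv.continuousOn_mul <| by
    rw [abs_of_pos (Metric.pos_of_mem_ball hw)]
    exact continuousOn_poissonKernel hw

/-- The Poisson integral at `w` of boundary data `v` on the circle of radius `R` about `0`. -/
def poissonIntegral (R : ℝ) (v : ℂ → ℝ) (w : ℂ) : ℝ :=
  Real.circleAverage (fun z => poissonKernel 0 w z * v z) 0 R

theorem poissonIntegral_mono (hw : w ∈ ball 0 R) (hu : CircleIntegrable u 0 R)
    (hv : CircleIntegrable v 0 R) (huv : ∀ z ∈ sphere 0 R, u z ≤ v z) :
    poissonIntegral R u w ≤ poissonIntegral R v w := by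
  refine Real.circleAverage_mono (circleIntegrable_poissonKernel_mul hw hu)
    (circleIntegrable_poissonKernel_mul hw hv) fun z hz => ?_
  rw [abs_of_pos (Metric.pos_of_mem_ball hw)] at hz
  exact mul_le_mul_of_nonneg_left (huv z hz) (poissonKernel_nonneg hw hz)

theorem poissonIntegral_nonneg (hw : w ∈ ball 0 R) (hv : ∀ z, 0 ≤ v z) :
    0 ≤ poissonIntegral R v w := by
  refine Real.circleAverage_nonneg_of_nonneg fun z hz => ?_
  rw [abs_of_pos (Metric.pos_of_mem_ball hw)] at hz
  exact mul_nonneg (poissonKernel_nonneg hw hz) (hv z)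

theorem poissonIntegral_add (hw : w ∈ ball 0 R) (hu : CircleIntegrable u 0 R)
    (hv : CircleIntegrable v 0 R) :
    poissonIntegral R (fun z => u z + v z) w = poissonIntegral R u w + poissonIntegral R v w := by
  simp only [poissonIntegral, mul_add]
  exact Real.circleAverage_fun_add (circleIntegrable_poissonKernel_mul hw hu)
    (circleIntegrable_poissonKernel_mul hw hv)

theorem poissonIntegral_const_mul (c : ℝ) (v : ℂ → ℝ) (w : ℂ) :
    poissonIntegral R (fun z => c * v z) w = c * poissonIntegral R v w := by
  simp only [poissonIntegral, mul_left_comm _ c]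
  exact Real.circleAverage_fun_smul (𝕜 := ℝ) (E := ℝ)

theorem poissonIntegral_re {Q : ℂ → ℂ} (hQ : DiffContOnCl ℂ Q (ball 0 R)) (hw : w ∈ ball 0 R) :
    poissonIntegral R (fun z => (Q z).re) w = (Q w).re := by
  have hR := Metric.pos_of_mem_ball hw
  have hQc : ContinuousOn Q (sphere 0 R) :=
    hQ.continuousOn_ball.mono Metric.sphere_subset_closedBall
  have hint : CircleIntegrable (poissonKernel 0 w • Q) 0 R :=
    ((continuousOn_poissonKernel hw).smul hQc).circleIntegrable hR.le
  rw [← hQ.circleAverage_poissonKernel_smul hw, ← reCLM_apply, ← reCLM.circleAverage_comp_comm hint]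
  refine Real.circleAverage_congr_sphere fun z _ => ?_
  rw [Function.comp_apply, Pi.smul_apply', reCLM_apply, smul_re, smul_eq_mul]

theorem poissonIntegral_const (hw : w ∈ ball 0 R) (c : ℝ) :
    poissonIntegral R (fun _ => c) w = c :=
  poissonIntegral_re (Q := fun _ => (c : ℂ)) diffContOnCl_const hw

theorem poissonIntegral_zero (hR : 0 < R) (v : ℂ → ℝ) :
    poissonIntegral R v 0 = Real.circleAverage v 0 R := by
  refine Real.circleAverage_congr_sphere fun z hz => ?_
  have hz0 : z ≠ 0 := Metric.ne_of_mem_sphere hz (abs_ne_zero.2 hR.ne')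
  rw [poissonKernel_def, sub_zero, sub_zero, norm_zero, sub_zero, zero_pow two_ne_zero, sub_zero,
    div_self (pow_ne_zero 2 (norm_ne_zero_iff.2 hz0)), one_mul]

theorem exists_differentiableOn_re_eq_poissonIntegral (hu : CircleIntegrable u 0 R) :
    ∃ S : ℂ → ℂ, DifferentiableOn ℂ S (ball 0 R) ∧
      ∀ w ∈ ball 0 R, (S w).re = poissonIntegral R u w := by
  refine ⟨fun w => Real.circleAverage (fun z => herglotzRieszKernel 0 w z • (u z : ℂ)) 0 R,
    differentiableOn_circleAverage_herglotzRieszKernel_smul ?_, fun w hw => ?_⟩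
  · rw [CircleIntegrable, intervalIntegrable_iff] at hu ⊢
    exact ofRealCLM.integrable_comp hu
  · rw [re_circleAverage_herglotzRieszKernel_smul hu hw, ← poissonKernel_eq_re_herglotzRieszKernel]
    rfl

theorem exp_poissonIntegral_le (hw : w ∈ ball 0 R) (hu : CircleIntegrable u 0 R)
    (hv : CircleIntegrable v 0 R) (huv : ∀ z ∈ sphere 0 R, Real.exp (u z) ≤ v z) :
    Real.exp (poissonIntegral R u w) ≤ poissonIntegral R v w := by
  set m := poissonIntegral R u w
  have htangent : ∀ z ∈ sphere 0 R, Real.exp m * u z + Real.exp m * (1 - m) ≤ v z := fun z hz =>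
    calc Real.exp m * u z + Real.exp m * (1 - m) = Real.exp m * (u z - m + 1) := by ring
      _ ≤ Real.exp m * Real.exp (u z - m) := by gcongr; exact Real.add_one_le_exp _
      _ = Real.exp (u z) := by rw [← Real.exp_add, add_sub_cancel]
      _ ≤ v z := huv z hz
  have hmu : CircleIntegrable (fun z => Real.exp m * u z) 0 R := hu.const_smul
  calc Real.exp m = poissonIntegral R (fun z => Real.exp m * u z + Real.exp m * (1 - m)) w := by
        rw [poissonIntegral_add hw hmu (circleIntegrable_const _ _ _), poissonIntegral_const_mul,
          poissonIntegral_const hw]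
        ring
    _ ≤ poissonIntegral R v w :=
        poissonIntegral_mono hw (hmu.add (circleIntegrable_const _ _ _)) hv htangent

/-- The real part of `Q₁ + conj Q₂` is that of the entire function `Q₁ + Q₂`. -/
theorem exists_eq_add_conj_of_mem_span_fourier (hR : R ≠ 0) {T : C(AddCircle (2 * Real.pi), ℂ)}
    (hT : T ∈ span ℂ (Set.range (fourier (T := 2 * Real.pi)))) :
    ∃ Q₁ Q₂ : ℂ → ℂ, Differentiable ℂ Q₁ ∧ Differentiable ℂ Q₂ ∧
      ∀ x : AddCircle (2 * Real.pi),
        T x = Q₁ (R * (x.toCircle : ℂ)) + conj (Q₂ (R * (x.toCircle : ℂ))) := by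
  have hpow (m : ℕ) (x : AddCircle (2 * Real.pi)) :
      fourier (m : ℤ) x = (R * (x.toCircle : ℂ) / R) ^ m := by
    rw [mul_div_cancel_left₀ _ (ofReal_ne_zero.2 hR), fourier_apply, natCast_zsmul,
      AddCircle.toCircle_nsmul, Circle.coe_pow]
  induction hT using span_induction with
  | mem T hT =>
    obtain ⟨n, rfl⟩ := hT
    obtain ⟨m, rfl | rfl⟩ := n.eq_nat_or_neg
    · exact ⟨fun z => (z / R) ^ m, fun _ => 0, by fun_prop, by fun_prop,
        fun x => by rw [hpow, map_zero, add_zero]⟩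
    · exact ⟨fun _ => 0, fun z => (z / R) ^ m, by fun_prop, by fun_prop,
        fun x => by rw [fourier_neg, hpow, zero_add]⟩
  | zero => exact ⟨0, 0, differentiable_const 0, differentiable_const 0, fun x => by simp⟩
  | add S T _ _ hS hT =>
    obtain ⟨A, B, hA, hB, hS⟩ := hS
    obtain ⟨C, D, hC, hD, hT⟩ := hT
    refine ⟨A + C, B + D, hA.add hC, hB.add hD, fun x => ?_⟩
    rw [ContinuousMap.add_apply, hS, hT, Pi.add_apply, Pi.add_apply, map_add]
    ring
  | smul a T _ hT =>
    obtain ⟨A, B, hA, hB, hT⟩ := hT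
    refine ⟨a • A, conj a • B, hA.const_smul a, hB.const_smul _, fun x => ?_⟩
    rw [ContinuousMap.smul_apply, hT, Pi.smul_apply, Pi.smul_apply, smul_eq_mul, smul_eq_mul,
      smul_eq_mul, map_mul, conj_conj, mul_add]

theorem exists_toCircle_eq_of_mem_sphere (hz : z ∈ sphere 0 R) :
    ∃ x : AddCircle (2 * Real.pi), R * (x.toCircle : ℂ) = z := by
  refine ⟨(z.arg : ℝ), ?_⟩
  rw [AddCircle.toCircle_apply_mk, div_self Real.two_pi_pos.ne', one_mul, Circle.coe_exp,
    ← mem_sphere_zero_iff_norm.1 hz, norm_mul_exp_arg_mul_I]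

theorem exists_differentiable_abs_sub_re_lt (hR : 0 < R) (hv : ContinuousOn v (sphere 0 R))
    {δ : ℝ} (hδ : 0 < δ) :
    ∃ Q : ℂ → ℂ, Differentiable ℂ Q ∧ ∀ z ∈ sphere 0 R, |v z - (Q z).re| < δ := by
  have : Fact (0 < 2 * Real.pi) := ⟨Real.two_pi_pos⟩
  have hmem (x : AddCircle (2 * Real.pi)) : (R * (x.toCircle : ℂ) : ℂ) ∈ sphere 0 R := by
    rw [mem_sphere_zero_iff_norm, norm_mul, Circle.norm_coe, mul_one, Complex.norm_of_nonneg hR.le]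
  let f : C(AddCircle (2 * Real.pi), ℂ) :=
    ⟨fun x => v (R * (x.toCircle : ℂ)), continuous_ofReal.comp <| hv.comp_continuous
      (continuous_const.mul (continuous_subtype_val.comp AddCircle.continuous_toCircle)) hmem⟩
  have hdense : f ∈ (span ℂ (Set.range (fourier (T := 2 * Real.pi)))).topologicalClosure := by
    rw [span_fourier_closure_eq_top]
    exact mem_top
  obtain ⟨T, hT, hfT⟩ := Metric.mem_closure_iff.1 hdense δ hδ
  obtain ⟨Q₁, Q₂, hQ₁, hQ₂, hTQ⟩ := exists_eq_add_conj_of_mem_span_fourier hR.ne' hT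
  refine ⟨Q₁ + Q₂, hQ₁.add hQ₂, fun z hz => ?_⟩
  obtain ⟨x, rfl⟩ := exists_toCircle_eq_of_mem_sphere hz
  calc |v (R * (x.toCircle : ℂ)) - ((Q₁ + Q₂) (R * (x.toCircle : ℂ))).re|
      = |(f x - T x).re| := by
        rw [hTQ, sub_re, add_re, conj_re, Pi.add_apply, add_re]
        rfl
    _ ≤ ‖f x - T x‖ := abs_re_le_norm _
    _ = dist (f x) (T x) := (dist_eq_norm _ _).symm
    _ < δ := (ContinuousMap.dist_apply_le_dist x).trans_lt hfT

/-- The maximum principle for `g * exp (-Q)`, where `re Q` approximates `v` on the circle. -/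
theorem norm_le_exp_poissonIntegral {g : ℂ → ℂ} (hg : DiffContOnCl ℂ g (ball 0 R))
    (hv : ContinuousOn v (sphere 0 R)) (hgv : ∀ z ∈ sphere 0 R, ‖g z‖ ≤ Real.exp (v z))
    (hw : w ∈ ball 0 R) : ‖g w‖ ≤ Real.exp (poissonIntegral R v w) := by
  have hR : 0 < R := Metric.pos_of_mem_ball hw
  have happrox : ∀ δ > 0, ‖g w‖ ≤ Real.exp (poissonIntegral R v w + 2 * δ) := by
    intro δ hδ
    obtain ⟨Q, hQ, hQv⟩ := exists_differentiable_abs_sub_re_lt hR hv hδ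
    have hfrontier : ∀ z ∈ frontier (ball 0 R), ‖g z * exp (-Q z)‖ ≤ Real.exp δ := fun z hz => by
      rw [frontier_ball _ hR.ne'] at hz
      rw [norm_mul, norm_exp, neg_re]
      calc ‖g z‖ * Real.exp (-(Q z).re) ≤ Real.exp (v z) * Real.exp (-(Q z).re) := by
            gcongr
            exact hgv z hz
        _ ≤ Real.exp δ := by
            rw [← Real.exp_add, Real.exp_le_exp, ← sub_eq_add_neg]
            exact (abs_lt.1 (hQv z hz)).2.le
    have hmax : ‖g w * exp (-Q w)‖ ≤ Real.exp δ :=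
      norm_le_of_forall_mem_frontier_norm_le Metric.isBounded_ball
        (hg.smul hQ.neg.cexp.diffContOnCl) hfrontier (subset_closure hw)
    have hQw : (Q w).re ≤ poissonIntegral R v w + δ := by
      have hvi : CircleIntegrable v 0 R := hv.circleIntegrable hR.le
      rw [← poissonIntegral_re hQ.diffContOnCl hw, ← poissonIntegral_const hw δ,
        ← poissonIntegral_add hw hvi (circleIntegrable_const _ _ _)]
      refine poissonIntegral_mono hw ?_ (hvi.add (circleIntegrable_const _ _ _)) fun z hz => ?_
      · exact (continuous_re.comp hQ.continuous).continuousOn.circleIntegrable hR.le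
      · linarith [(abs_lt.1 (hQv z hz)).1]
    rw [norm_mul, norm_exp, neg_re, Real.exp_neg, mul_inv_le_iff₀ (Real.exp_pos _),
      ← Real.exp_add] at hmax
    exact hmax.trans (Real.exp_le_exp.2 (by linarith))
  have hlim : Tendsto (fun δ : ℝ => Real.exp (poissonIntegral R v w + 2 * δ)) (𝓝[>] 0)
      (𝓝 (Real.exp (poissonIntegral R v w + 2 * 0))) :=
    (Continuous.tendsto (by fun_prop) 0).mono_left nhdsWithin_le_nhds
  rw [mul_zero, add_zero] at hlim
  exact ge_of_tendsto hlim (eventually_nhdsWithin_of_forall happrox)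

end PoissonIntegral

section QuotientOfBounded

variable {g q : ℂ → ℂ} {w z : ℂ} {r c A : ℝ}

theorem continuousAt_poissonKernel (h : z ≠ w) : ContinuousAt (poissonKernel 0 w) z := by
  have hK : poissonKernel 0 w = fun z => (‖z‖ ^ 2 - ‖w‖ ^ 2) / ‖z - w‖ ^ 2 := by
    funext z
    rw [poissonKernel_def, sub_zero, sub_zero]
  rw [hK]
  exact ContinuousAt.div (by fun_prop) (by fun_prop)
    (pow_ne_zero 2 (norm_ne_zero_iff.2 (sub_ne_zero.2 h)))

theorem le_exp_posLog {x : ℝ} (hx : 0 ≤ x) : x ≤ Real.exp (posLog x) := by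
  rw [Real.posLog_eq_log_max_one hx, Real.exp_log (lt_max_of_lt_left one_pos)]
  exact le_max_right _ _

theorem posLog_norm_le_neg_log_max {a b : ℂ} (hb : ‖b‖ ≤ 1) (hab : ‖a * b‖ ≤ 1)
    (hA : posLog ‖a‖ ≤ A) : posLog ‖a‖ ≤ -Real.log (max ‖b‖ (Real.exp (-A))) := by
  rcases le_total ‖b‖ (Real.exp (-A)) with h | h
  · rwa [max_eq_right h, Real.log_exp, neg_neg]
  have hb0 : 0 < ‖b‖ := (Real.exp_pos _).trans_le h
  have hlogb : Real.log ‖b‖ ≤ 0 := Real.log_nonpos hb0.le hb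
  rw [max_eq_left h, Real.posLog_apply]
  refine max_le (neg_nonneg.2 hlogb) ?_
  rcases eq_or_ne a 0 with rfl | ha
  · rw [norm_zero, Real.log_zero]
    exact neg_nonneg.2 hlogb
  · have hlogab : Real.log (‖a‖ * ‖b‖) ≤ 0 := by
      rw [← norm_mul]
      exact Real.log_nonpos (norm_nonneg _) hab
    rw [Real.log_mul (norm_ne_zero_iff.2 ha) hb0.ne'] at hlogab
    linarith

theorem continuousOn_posLog_norm_sphere (hg : DifferentiableOn ℂ g (ball 0 1)) (hr : r < 1) :
    ContinuousOn (fun z => posLog ‖g z‖) (sphere 0 r) :=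
  Real.continuous_posLog.comp_continuousOn (hg.continuousOn.mono
    (Metric.sphere_subset_closedBall.trans (Metric.closedBall_subset_ball hr))).norm

theorem circleAverage_posLog_norm_le (hg : DifferentiableOn ℂ g (ball 0 1))
    (hq : DifferentiableOn ℂ q (ball 0 1)) (hq1 : ∀ z ∈ ball (0 : ℂ) 1, ‖q z‖ ≤ 1)
    (hgq : ∀ z ∈ ball (0 : ℂ) 1, ‖g z * q z‖ ≤ 1) (hq0 : q 0 ≠ 0) (hr0 : 0 < r) (hr1 : r < 1) :
    Real.circleAverage (fun z => posLog ‖g z‖) 0 r ≤ -Real.log ‖q 0‖ := by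
  have hsub : closedBall (0 : ℂ) r ⊆ ball 0 1 := Metric.closedBall_subset_ball hr1
  have hsphere : sphere (0 : ℂ) r ⊆ ball 0 1 := Metric.sphere_subset_closedBall.trans hsub
  have hu := continuousOn_posLog_norm_sphere hg hr1
  obtain ⟨A, hA⟩ := (isCompact_sphere (0 : ℂ) r).bddAbove_image hu
  let v : ℂ → ℝ := fun z => Real.log (max ‖q z‖ (Real.exp (-A)))
  have hpos (z : ℂ) : 0 < max ‖q z‖ (Real.exp (-A)) := lt_max_of_lt_right (Real.exp_pos _)
  have hv : ContinuousOn v (sphere 0 r) :=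
    ContinuousOn.log ((hq.continuousOn.mono hsphere).norm.sup continuousOn_const)
      fun z _ => (hpos z).ne'
  have hq0v : ‖q 0‖ ≤ Real.exp (poissonIntegral r v 0) := by
    refine norm_le_exp_poissonIntegral ((hq.mono ?_).diffContOnCl) hv (fun z _ => ?_)
      (Metric.mem_ball_self hr0)
    · rwa [closure_ball _ hr0.ne']
    · rw [Real.exp_log (hpos z)]
      exact le_max_left _ _
  rw [poissonIntegral_zero hr0, ← Real.log_le_iff_le_exp (norm_pos_iff.2 hq0)] at hq0v
  calc Real.circleAverage (fun z => posLog ‖g z‖) 0 r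
      ≤ Real.circleAverage (fun z => -v z) 0 r := by
        refine Real.circleAverage_mono (hu.circleIntegrable hr0.le)
          (hv.neg.circleIntegrable hr0.le) fun z hz => ?_
        rw [abs_of_pos hr0] at hz
        exact posLog_norm_le_neg_log_max (hq1 z (hsphere hz)) (hgq z (hsphere hz))
          (hA (Set.mem_image_of_mem _ hz))
    _ = -Real.circleAverage v 0 r := by
        simp only [Real.circleAverage, intervalIntegral.integral_neg, smul_neg]
    _ ≤ -Real.log ‖q 0‖ := neg_le_neg hq0v

theorem continuousOn_truncated_poissonKernel_mul (hw : ‖w‖ < 1) (hc : poissonKernel 0 w 1 < c)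
    {u : ℂ → ℝ} (hu : ContinuousOn u (closedBall 0 1 \ {1})) :
    ContinuousOn (fun z => max (poissonKernel 0 w z - c) 0 * u z)
      {z : ℂ | ‖z - 0‖ ∈ Set.Ioc ‖w‖ 1} := by
  intro z hz
  rw [Set.mem_ofPred_eq, sub_zero] at hz
  have hzw : z ≠ w := by
    rintro rfl
    exact lt_irrefl _ hz.1
  rcases eq_or_ne z 1 with rfl | hz1
  · refine (continuousAt_const (y := (0 : ℝ)).congr ?_).continuousWithinAt
    filter_upwards [(continuousAt_poissonKernel hzw).eventually_lt_const hc] with z hz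
    rw [max_eq_right (sub_nonpos.2 hz.le), zero_mul]
  · refine ContinuousWithinAt.mul
      (((continuousAt_poissonKernel hzw).sub continuousAt_const).sup
        continuousAt_const).continuousWithinAt ?_
    refine (hu z ⟨mem_closedBall_zero_iff.2 hz.2, hz1⟩).mono_of_mem_nhdsWithin ?_
    filter_upwards [nhdsWithin_le_nhds (isOpen_ne.mem_nhds hz1), self_mem_nhdsWithin] with y hy hyw
    rw [sub_zero] at hyw
    exact ⟨mem_closedBall_zero_iff.2 hyw.2, hy⟩

theorem norm_le_exp_truncated_circleAverage_add (hg : DifferentiableOn ℂ g (ball 0 1))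
    (hq : DifferentiableOn ℂ q (ball 0 1)) (hq1 : ∀ z ∈ ball (0 : ℂ) 1, ‖q z‖ ≤ 1)
    (hgq : ∀ z ∈ ball (0 : ℂ) 1, ‖g z * q z‖ ≤ 1) (hq0 : q 0 ≠ 0) (hc : 0 ≤ c)
    (hwr : ‖w‖ < r) (hr : r < 1) :
    ‖g w‖ ≤ Real.exp (Real.circleAverage
      (fun z => max (poissonKernel 0 w z - c) 0 * posLog ‖g z‖) 0 r + c * -Real.log ‖q 0‖) := by
  have hr0 : 0 < r := (norm_nonneg w).trans_lt hwr
  have hw : w ∈ ball (0 : ℂ) r := mem_ball_zero_iff.2 hwr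
  have hu := continuousOn_posLog_norm_sphere hg hr
  have hK := continuousOn_poissonKernel hw
  have htrunc : CircleIntegrable
      (fun z => max (poissonKernel 0 w z - c) 0 * posLog ‖g z‖) 0 r :=
    (((hK.sub continuousOn_const).sup continuousOn_const).mul hu).circleIntegrable hr0.le
  have hconst : CircleIntegrable (fun z => c * posLog ‖g z‖) 0 r :=
    (continuousOn_const.mul hu).circleIntegrable hr0.le
  have hpoisson : ‖g w‖ ≤ Real.exp (poissonIntegral r (fun z => posLog ‖g z‖) w) := by
    refine norm_le_exp_poissonIntegral (hg.mono ?_).diffContOnCl hu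
      (fun z _ => le_exp_posLog (norm_nonneg _)) hw
    rw [closure_ball _ hr0.ne']
    exact Metric.closedBall_subset_ball hr
  refine hpoisson.trans (Real.exp_le_exp.2 ?_)
  calc poissonIntegral r (fun z => posLog ‖g z‖) w
      ≤ Real.circleAverage (fun z => max (poissonKernel 0 w z - c) 0 * posLog ‖g z‖ +
          c * posLog ‖g z‖) 0 r := by
        refine Real.circleAverage_mono ((hK.mul hu).circleIntegrable hr0.le)
          (htrunc.add hconst) fun z _ => ?_
        rw [← add_mul]
        exact mul_le_mul_of_nonneg_right (by linarith [le_max_left (poissonKernel 0 w z - c) 0])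
          Real.posLog_nonneg
    _ = Real.circleAverage (fun z => max (poissonKernel 0 w z - c) 0 * posLog ‖g z‖) 0 r +
          c * Real.circleAverage (fun z => posLog ‖g z‖) 0 r := by
        rw [Real.circleAverage_fun_add htrunc hconst, ← smul_eq_mul,
          ← Real.circleAverage_fun_smul]
        rfl
    _ ≤ _ := by
        gcongr
        exact circleAverage_posLog_norm_le hg hq hq1 hgq hq0 hr0 hr

/-- The boundary singularity at `1` is handled by truncating the Poisson kernel below its value
there; what is cut off is controlled by the circle averages of `log⁺ ‖g‖`. -/
theorem norm_le_exp_poissonIntegral_add_of_lt (hg : DifferentiableOn ℂ g (ball 0 1))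
    (hgc : ContinuousOn g (closedBall 0 1 \ {1})) (hq : DifferentiableOn ℂ q (ball 0 1))
    (hq1 : ∀ z ∈ ball (0 : ℂ) 1, ‖q z‖ ≤ 1) (hgq : ∀ z ∈ ball (0 : ℂ) 1, ‖g z * q z‖ ≤ 1)
    (hq0 : q 0 ≠ 0) (hint : CircleIntegrable (fun z => posLog ‖g z‖) 0 1)
    (hw : w ∈ ball (0 : ℂ) 1) (hc : poissonKernel 0 w 1 < c) :
    ‖g w‖ ≤ Real.exp
      (poissonIntegral 1 (fun z => posLog ‖g z‖) w + c * -Real.log ‖q 0‖) := by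
  have hw1 : ‖w‖ < 1 := mem_ball_zero_iff.1 hw
  have hc0 : 0 ≤ c :=
    (poissonKernel_nonneg hw (mem_sphere_zero_iff_norm.2 norm_one)).trans hc.le
  let h : ℂ → ℝ := fun z => max (poissonKernel 0 w z - c) 0 * posLog ‖g z‖
  have hcont := continuousOn_truncated_poissonKernel_mul hw1 hc
    (Real.continuous_posLog.comp_continuousOn hgc.norm)
  have hlim : Tendsto (Real.circleAverage h 0) (𝓝[<] 1) (𝓝 (Real.circleAverage h 0 1)) := by
    refine ((Real.ContinuousOn.circleAverage hcont fun r hr => (norm_nonneg w).trans hr.1.le) 1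
      ⟨hw1, le_rfl⟩).mono_left ?_
    rw [← nhdsWithin_Ioo_eq_nhdsLT hw1]
    exact nhdsWithin_mono _ Set.Ioo_subset_Ioc_self
  have hradius : ‖g w‖ ≤ Real.exp (Real.circleAverage h 0 1 + c * -Real.log ‖q 0‖) := by
    refine ge_of_tendsto ((Real.continuous_exp.tendsto _).comp (hlim.add_const _)) ?_
    filter_upwards [Ioo_mem_nhdsLT hw1] with r hr
    exact norm_le_exp_truncated_circleAverage_add hg hq hq1 hgq hq0 hc0 hr.1 hr.2
  refine hradius.trans (Real.exp_le_exp.2 (add_le_add_left ?_ _))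
  refine Real.circleAverage_mono (hint.continuousOn_mul ?_)
    (circleIntegrable_poissonKernel_mul hw hint) fun z hz => ?_
  · rw [abs_one]
    exact ((continuousOn_poissonKernel hw).sub continuousOn_const).sup continuousOn_const
  · rw [abs_one] at hz
    exact mul_le_mul_of_nonneg_right
      (max_le (sub_le_self _ hc0) (poissonKernel_nonneg hw hz)) Real.posLog_nonneg

theorem norm_le_exp_poissonIntegral_add (hg : DifferentiableOn ℂ g (ball 0 1))
    (hgc : ContinuousOn g (closedBall 0 1 \ {1})) (hq : DifferentiableOn ℂ q (ball 0 1))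
    (hq1 : ∀ z ∈ ball (0 : ℂ) 1, ‖q z‖ ≤ 1) (hgq : ∀ z ∈ ball (0 : ℂ) 1, ‖g z * q z‖ ≤ 1)
    (hq0 : q 0 ≠ 0) (hint : CircleIntegrable (fun z => posLog ‖g z‖) 0 1)
    (hw : w ∈ ball (0 : ℂ) 1) :
    ‖g w‖ ≤ Real.exp (poissonIntegral 1 (fun z => posLog ‖g z‖) w +
      poissonKernel 0 w 1 * -Real.log ‖q 0‖) := by
  have hlim : Tendsto (fun c : ℝ => Real.exp
      (poissonIntegral 1 (fun z => posLog ‖g z‖) w + c * -Real.log ‖q 0‖))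
      (𝓝[>] poissonKernel 0 w 1) (𝓝 (Real.exp
        (poissonIntegral 1 (fun z => posLog ‖g z‖) w + poissonKernel 0 w 1 * -Real.log ‖q 0‖))) :=
    (Continuous.tendsto (by fun_prop) _).mono_left nhdsWithin_le_nhds
  exact ge_of_tendsto hlim (eventually_nhdsWithin_of_forall fun c hc =>
    norm_le_exp_poissonIntegral_add_of_lt hg hgc hq hq1 hgq hq0 hint hw hc)

end QuotientOfBounded

section CayleyTransform

variable {a z ζ : ℂ} {t θ : ℝ}

/-- The Cayley transform of the upper half-plane onto the unit disc that sends `a` to `0`. -/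
def toDisc (a z : ℂ) : ℂ := (z - a) / (z - conj a)

/-- The inverse Cayley transform: `ofDisc a` inverts `toDisc a` away from the junk value at `1`. -/
def ofDisc (a ζ : ℂ) : ℂ := (a - conj a * ζ) / (1 - ζ)

theorem sub_conj_ne_zero (ha : 0 < a.im) (hz : 0 ≤ z.im) : z - conj a ≠ 0 := fun h => by
  have him : z.im + a.im = 0 := by
    simpa only [sub_im, conj_im, sub_neg_eq_add, zero_im] using congrArg im h
  linarith

theorem norm_self_sub_conj (ha : 0 < a.im) : ‖a - conj a‖ = 2 * a.im := by
  rw [Complex.sub_conj, norm_mul, norm_I, mul_one, Complex.norm_of_nonneg (by positivity)]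

theorem one_sub_toDisc (ha : 0 < a.im) (hz : 0 ≤ z.im) :
    1 - toDisc a z = (a - conj a) / (z - conj a) := by
  rw [toDisc, one_sub_div (sub_conj_ne_zero ha hz), sub_sub_sub_cancel_left]

theorem toDisc_ne_one (ha : 0 < a.im) (hz : 0 ≤ z.im) : toDisc a z ≠ 1 := by
  rw [← sub_ne_zero, ← neg_ne_zero, neg_sub, one_sub_toDisc ha hz]
  exact div_ne_zero (sub_conj_ne_zero ha ha.le) (sub_conj_ne_zero ha hz)

theorem ofDisc_toDisc (ha : 0 < a.im) (hz : 0 ≤ z.im) : ofDisc a (toDisc a z) = z := by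
  have hza := sub_conj_ne_zero ha hz
  rw [ofDisc, one_sub_toDisc ha hz, toDisc]
  have haa := sub_conj_ne_zero ha ha.le
  field_simp
  ring

theorem toDisc_ofDisc (ha : 0 < a.im) (hζ : ζ ≠ 1) : toDisc a (ofDisc a ζ) = ζ := by
  have h1 : 1 - ζ ≠ 0 := sub_ne_zero.2 hζ.symm
  have haa := sub_conj_ne_zero ha ha.le
  have hnum : ofDisc a ζ - a = (a - conj a) * ζ / (1 - ζ) := by
    rw [ofDisc]
    field_simp
    ring
  have hden : ofDisc a ζ - conj a = (a - conj a) / (1 - ζ) := by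
    rw [ofDisc]
    field_simp
    ring
  rw [toDisc, hnum, hden, div_div_div_cancel_right₀ h1, mul_div_cancel_left₀ _ haa]

theorem one_sub_norm_toDisc_sq (ha : 0 < a.im) (hz : 0 ≤ z.im) :
    1 - ‖toDisc a z‖ ^ 2 = 4 * z.im * a.im / ‖z - conj a‖ ^ 2 := by
  rw [toDisc, norm_div, div_pow,
    one_sub_div (pow_ne_zero 2 (norm_ne_zero_iff.2 (sub_conj_ne_zero ha hz)))]
  congr 1
  rw [← normSq_eq_norm_sq, ← normSq_eq_norm_sq, normSq_apply, normSq_apply, sub_re, sub_im, sub_re,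
    sub_im, conj_re, conj_im]
  ring

theorem norm_toDisc_ofReal (ha : 0 < a.im) (t : ℝ) : ‖toDisc a t‖ = 1 := by
  have h := one_sub_norm_toDisc_sq (z := t) ha (ofReal_im t).ge
  rw [ofReal_im, mul_zero, zero_mul, zero_div, sub_eq_zero] at h
  exact (sq_eq_sq₀ (norm_nonneg _) zero_le_one).1 (by rw [← h, one_pow])

theorem toDisc_mem_ball (ha : 0 < a.im) (hz : 0 < z.im) : toDisc a z ∈ ball (0 : ℂ) 1 := by
  have hnorm : 0 < ‖z - conj a‖ := norm_pos_iff.2 (sub_conj_ne_zero ha hz.le)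
  have hpos : 0 < 1 - ‖toDisc a z‖ ^ 2 := by
    rw [one_sub_norm_toDisc_sq ha hz.le]
    positivity
  rw [mem_ball_zero_iff, ← sq_lt_one_iff₀ (norm_nonneg _)]
  linarith

theorem im_ofDisc (a ζ : ℂ) : (ofDisc a ζ).im = a.im * (1 - ‖ζ‖ ^ 2) / ‖1 - ζ‖ ^ 2 := by
  rw [ofDisc, div_im, ← normSq_eq_norm_sq, ← normSq_eq_norm_sq, ← sub_div, normSq_apply ζ]
  simp only [sub_re, sub_im, mul_re, mul_im, conj_re, conj_im, one_re, one_im]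
  ring

theorem im_ofDisc_pos (ha : 0 < a.im) (hζ : ζ ∈ ball (0 : ℂ) 1) : 0 < (ofDisc a ζ).im := by
  rw [mem_ball_zero_iff] at hζ
  have h1 : 0 < ‖1 - ζ‖ := by
    rw [norm_pos_iff, sub_ne_zero]
    rintro rfl
    exact hζ.ne norm_one
  have h2 : 0 < 1 - ‖ζ‖ ^ 2 := sub_pos.2 ((sq_lt_one_iff₀ (norm_nonneg ζ)).2 hζ)
  rw [im_ofDisc]
  positivity

theorem im_ofDisc_nonneg (ha : 0 < a.im) (hζ : ζ ∈ closedBall (0 : ℂ) 1) :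
    0 ≤ (ofDisc a ζ).im := by
  have h2 : 0 ≤ 1 - ‖ζ‖ ^ 2 :=
    sub_nonneg.2 (pow_le_one₀ (norm_nonneg ζ) (mem_closedBall_zero_iff.1 hζ))
  rw [im_ofDisc]
  positivity

theorem hasDerivAt_ofDisc (a : ℂ) (hζ : ζ ≠ 1) :
    HasDerivAt (ofDisc a) ((a - conj a) / (1 - ζ) ^ 2) ζ := by
  refine ((((hasDerivAt_id' ζ).const_mul (conj a)).const_sub a).div
    ((hasDerivAt_id' ζ).const_sub 1) (sub_ne_zero.2 hζ.symm)).congr_deriv ?_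
  ring

theorem poissonKernel_toDisc_one (ha : 0 < a.im) (hz : 0 < z.im) :
    poissonKernel 0 (toDisc a z) 1 = z.im / a.im := by
  have hza : ‖z - conj a‖ ≠ 0 := norm_ne_zero_iff.2 (sub_conj_ne_zero ha hz.le)
  rw [poissonKernel_def, sub_zero, sub_zero, norm_one, one_pow, one_sub_norm_toDisc_sq ha hz.le,
    one_sub_toDisc ha hz.le, norm_div, norm_self_sub_conj ha]
  field_simp
  norm_num

theorem norm_one_sub_toDisc (ha : 0 < a.im) (hz : 0 ≤ z.im) :
    ‖1 - toDisc a z‖ = 2 * a.im / ‖z - conj a‖ := by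
  rw [one_sub_toDisc ha hz, norm_div, norm_self_sub_conj ha]

/-- The Poisson kernel of the half-plane, up to the Jacobian `2 a.im / ‖1 - toDisc a t‖²`. -/
theorem poissonKernel_toDisc_ofReal (ha : 0 < a.im) (hz : 0 < z.im) (t : ℝ) :
    poissonKernel 0 (toDisc a z) (toDisc a t) =
      2 * z.im / ‖t - z‖ ^ 2 * (2 * a.im / ‖1 - toDisc a t‖ ^ 2) := by
  have ht0 : 0 ≤ (t : ℂ).im := (ofReal_im t).ge
  have hza := sub_conj_ne_zero ha hz.le
  have hta := sub_conj_ne_zero ha ht0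
  have hdiff : toDisc a t - toDisc a z =
      (a - conj a) * (t - z) / ((t - conj a) * (z - conj a)) := by
    rw [toDisc, toDisc]
    field_simp
    ring
  have hza' := norm_ne_zero_iff.2 hza
  have hta' := norm_ne_zero_iff.2 hta
  have htz : ‖t - z‖ ≠ 0 := by
    rw [norm_ne_zero_iff, sub_ne_zero]
    rintro rfl
    exact hz.ne' (ofReal_im t)
  rw [poissonKernel_def, sub_zero, sub_zero, norm_toDisc_ofReal ha, one_pow,
    one_sub_norm_toDisc_sq ha hz.le, norm_one_sub_toDisc ha ht0, hdiff, norm_div, norm_mul,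
    norm_mul, norm_self_sub_conj ha]
  field_simp
  norm_num

theorem poissonKernel_toDisc_ofReal_le (ha : 0 < a.im) (hz : 0 < z.im) (t : ℝ) :
    poissonKernel 0 (toDisc a z) (toDisc a t) ≤
      2 / z.im * (2 * a.im / ‖1 - toDisc a t‖ ^ 2) := by
  have hle : z.im ≤ ‖(t : ℂ) - z‖ := by
    have h := abs_im_le_norm ((t : ℂ) - z)
    rw [sub_im, ofReal_im, zero_sub, abs_neg] at h
    exact (le_abs_self _).trans h
  rw [poissonKernel_toDisc_ofReal ha hz]
  refine mul_le_mul_of_nonneg_right ?_ (by positivity)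
  calc 2 * z.im / ‖t - z‖ ^ 2 ≤ 2 * z.im / z.im ^ 2 := by gcongr
    _ = 2 / z.im := by field_simp

/-- The correspondence between the unit circle and the real line induced by `ofDisc a`, in the
angular coordinate. -/
def angleToReal (a : ℂ) (θ : ℝ) : ℝ := (ofDisc a (circleMap 0 1 θ)).re

theorem circleMap_ne_one (hθ : θ ∈ Set.Ioo 0 (2 * Real.pi)) : circleMap 0 1 θ ≠ 1 := fun h => by
  have h0 : circleMap 0 1 0 = 1 := by rw [circleMap_zero, ofReal_zero, zero_mul, exp_zero,
    ofReal_one, one_mul]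
  refine hθ.1.ne' (eq_of_circleMap_eq one_ne_zero ?_ (h.trans h0.symm))
  rw [sub_zero, abs_of_pos hθ.1]
  exact hθ.2

theorem ofDisc_circleMap (a : ℂ) (θ : ℝ) :
    ofDisc a (circleMap 0 1 θ) = (angleToReal a θ : ℂ) := by
  refine Complex.ext (ofReal_re _).symm ?_
  rw [im_ofDisc, norm_circleMap_zero, abs_one, one_pow, sub_self, mul_zero, zero_div, ofReal_im]

theorem toDisc_angleToReal (ha : 0 < a.im) (hθ : θ ∈ Set.Ioo 0 (2 * Real.pi)) :
    toDisc a (angleToReal a θ) = circleMap 0 1 θ := by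
  rw [← ofDisc_circleMap, toDisc_ofDisc ha (circleMap_ne_one hθ)]

theorem hasDerivAt_angleToReal (a : ℂ) (hθ : θ ∈ Set.Ioo 0 (2 * Real.pi)) :
    HasDerivAt (angleToReal a) (2 * a.im / ‖1 - circleMap 0 1 θ‖ ^ 2) θ := by
  have hne := circleMap_ne_one hθ
  refine (reCLM.hasFDerivAt.comp_hasDerivAt θ ((hasDerivAt_ofDisc a hne).comp_of_eq θ
    (hasDerivAt_circleMap 0 1 θ) rfl)).congr_deriv ?_
  generalize hζ : circleMap 0 1 θ = ζ at hne ⊢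
  have hζζ : ζ * conj ζ = 1 := by
    rw [← hζ, mul_conj', norm_circleMap_zero, abs_one, ofReal_one, one_pow]
  have h1 : 1 - ζ ≠ 0 := sub_ne_zero.2 hne.symm
  have h2 : 1 - conj ζ ≠ 0 := by rwa [← map_one conj, ← map_sub, map_ne_zero]
  have hreal : (a - conj a) / (1 - ζ) ^ 2 * (ζ * I) = ((2 * a.im / ‖1 - ζ‖ ^ 2 : ℝ) : ℂ) := by
    rw [ofReal_div, ofReal_pow, ← mul_conj' (1 - ζ), Complex.sub_conj, map_sub, map_one,
      div_mul_eq_mul_div, div_eq_div_iff (pow_ne_zero 2 h1) (mul_ne_zero h1 h2)]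
    push_cast
    linear_combination (2 * a.im * ζ * (1 - ζ) * (1 - conj ζ)) * I_mul_I +
      (2 * a.im * (1 - ζ)) * hζζ
  rw [hreal, reCLM_apply, ofReal_re]

theorem angleToReal_injOn (ha : 0 < a.im) :
    Set.InjOn (angleToReal a) (Set.Ioo 0 (2 * Real.pi)) := fun x hx y hy h =>
  injOn_circleMap_of_abs_sub_le' one_ne_zero (sub_zero _).le (Set.Ioo_subset_Ico_self hx)
    (Set.Ioo_subset_Ico_self hy) <| by
      rw [← toDisc_angleToReal ha hx, ← toDisc_angleToReal ha hy, h]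

theorem angleToReal_image (ha : 0 < a.im) :
    angleToReal a '' Set.Ioo 0 (2 * Real.pi) = Set.univ := by
  refine Set.eq_univ_of_forall fun t => ?_
  have ht0 : 0 ≤ (t : ℂ).im := (ofReal_im t).ge
  have hmem : toDisc a t ∈ circleMap 0 1 '' Set.Ioc 0 (2 * Real.pi) := by
    rw [image_circleMap_Ioc, abs_one, mem_sphere_zero_iff_norm, norm_toDisc_ofReal ha]
  obtain ⟨θ, hθ, hθt⟩ := hmem
  have hθ2 : θ ≠ 2 * Real.pi := by
    rintro rfl
    refine toDisc_ne_one ha ht0 (hθt.symm.trans ?_)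
    rw [circleMap_zero, ofReal_mul, ofReal_ofNat, exp_two_pi_mul_I, ofReal_one, one_mul]
  refine ⟨θ, ⟨hθ.1, hθ.2.lt_of_ne hθ2⟩, ?_⟩
  rw [angleToReal, hθt, ofDisc_toDisc ha ht0, ofReal_re]

theorem integrableOn_comp_angleToReal (ha : 0 < a.im) {f : ℝ → ℝ} (hf : Integrable f) :
    IntegrableOn (fun θ => 2 * a.im / ‖1 - circleMap 0 1 θ‖ ^ 2 * f (angleToReal a θ))
      (Set.Ioo 0 (2 * Real.pi)) := by
  have h := (integrableOn_image_iff_integrableOn_abs_deriv_smul measurableSet_Ioo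
    (fun x hx => (hasDerivAt_angleToReal a hx).hasDerivWithinAt) (angleToReal_injOn ha) f).1
    (by rw [angleToReal_image ha]; exact hf.integrableOn)
  refine h.congr_fun (fun θ _ => ?_) measurableSet_Ioo
  dsimp only
  rw [smul_eq_mul, abs_of_nonneg (by positivity)]

theorem integral_comp_angleToReal (ha : 0 < a.im) (f : ℝ → ℝ) :
    ∫ θ in Set.Ioo 0 (2 * Real.pi),
      2 * a.im / ‖1 - circleMap 0 1 θ‖ ^ 2 * f (angleToReal a θ) = ∫ t, f t := by
  have h := integral_image_eq_integral_abs_deriv_smul measurableSet_Ioo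
    (fun x hx => (hasDerivAt_angleToReal a hx).hasDerivWithinAt) (angleToReal_injOn ha) f
  rw [angleToReal_image ha, setIntegral_univ] at h
  rw [h]
  refine setIntegral_congr_fun measurableSet_Ioo fun θ _ => ?_
  rw [smul_eq_mul, abs_of_nonneg (by positivity)]

end CayleyTransform

section BoundedType

variable {f g b : ℂ → ℂ}

theorem isOpen_upperHalf : IsOpen upperHalf := isOpen_lt continuous_const continuous_im

theorem isPreconnected_upperHalf : IsPreconnected upperHalf :=
  (convex_halfSpace_im_gt 0).isPreconnected

theorem I_mul_mem_upperHalf {y : ℝ} (hy : 0 < y) : I * (y : ℂ) ∈ upperHalf := by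
  rwa [upperHalf, Set.mem_ofPred_eq, I_mul_im, ofReal_re]

theorem meanType_le_zero_iff :
    meanType f ≤ 0 ↔ ∀ ε > 0, ∀ᶠ y : ℝ in atTop, ‖f (I * y)‖ ≤ Real.exp (ε * y) := by
  have log_div_le_iff : ∀ {ε y : ℝ}, 0 < y →
      (ENNReal.log ‖f (I * (y : ℂ))‖ₑ / (y : EReal) ≤ (ε : EReal) ↔
        ‖f (I * y)‖ ≤ Real.exp (ε * y)) := by
    intro ε y hy
    rw [EReal.div_le_iff_le_mul (by exact_mod_cast hy) (EReal.coe_ne_top y), ← ofReal_norm,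
      ENNReal.log_ofReal, ← EReal.coe_mul]
    split_ifs with h
    · simp only [bot_le, true_iff]
      exact h.trans (Real.exp_pos _).le
    · rw [EReal.coe_le_coe_iff, Real.log_le_iff_le_exp (not_le.1 h), mul_comm y ε]
  constructor
  · intro h ε hε
    have h1 : meanType f < (ε : EReal) := lt_of_le_of_lt h (by exact_mod_cast hε)
    filter_upwards [eventually_lt_of_limsup_lt h1, eventually_gt_atTop 0] with y hy hy0
    exact (log_div_le_iff hy0).1 hy.le
  · intro h
    refine EReal.le_of_forall_lt_iff_le.1 fun ε hε => ?_
    refine limsup_le_of_le (by isBoundedDefault) ?_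
    filter_upwards [h ε (by exact_mod_cast hε), eventually_gt_atTop 0] with y hy hy0
    exact (log_div_le_iff hy0).2 hy

theorem eventually_const_le_exp (c : ℝ) {ε : ℝ} (hε : 0 < ε) :
    ∀ᶠ y : ℝ in atTop, c ≤ Real.exp (ε * y) :=
  (Real.tendsto_exp_atTop.comp (tendsto_id.const_mul_atTop hε)).eventually_ge_atTop c

theorem meanType_le_zero_of_norm_le (hf : meanType f ≤ 0)
    (h : ∀ z ∈ upperHalf, ‖g z‖ ≤ ‖f z‖) : meanType g ≤ 0 := by
  rw [meanType_le_zero_iff] at hf ⊢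
  intro ε hε
  filter_upwards [hf ε hε, eventually_gt_atTop 0] with y hy hy0
  exact (h _ (I_mul_mem_upperHalf hy0)).trans hy

theorem meanType_add_le_zero (hf : meanType f ≤ 0) (hg : meanType g ≤ 0) :
    meanType (fun z => f z + g z) ≤ 0 := by
  rw [meanType_le_zero_iff] at *
  intro ε hε
  filter_upwards [hf (ε / 2) (half_pos hε), hg (ε / 2) (half_pos hε),
    eventually_const_le_exp 2 (half_pos hε)] with y h1 h2 h3
  calc ‖f (I * y) + g (I * y)‖ ≤ Real.exp (ε / 2 * y) + Real.exp (ε / 2 * y) :=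
        (norm_add_le _ _).trans (add_le_add h1 h2)
    _ = 2 * Real.exp (ε / 2 * y) := by ring
    _ ≤ Real.exp (ε / 2 * y) * Real.exp (ε / 2 * y) := by gcongr
    _ = Real.exp (ε * y) := by rw [← Real.exp_add]; ring_nf

theorem meanType_const_mul_le_zero (hf : meanType f ≤ 0) (c : ℂ) :
    meanType (fun z => c * f z) ≤ 0 := by
  rw [meanType_le_zero_iff] at *
  intro ε hε
  filter_upwards [hf (ε / 2) (half_pos hε), eventually_const_le_exp ‖c‖ (half_pos hε)]
    with y h1 h2
  rw [norm_mul]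
  calc ‖c‖ * ‖f (I * y)‖ ≤ Real.exp (ε / 2 * y) * Real.exp (ε / 2 * y) := by gcongr
    _ = Real.exp (ε * y) := by rw [← Real.exp_add]; ring_nf

theorem IsBoundedAnalytic.const (c : ℂ) : IsBoundedAnalytic fun _ => c :=
  ⟨differentiableOn_const _, ‖c‖, fun _ _ => le_rfl⟩

theorem IsBoundedAnalytic.add (hf : IsBoundedAnalytic f)
    (hg : IsBoundedAnalytic g) : IsBoundedAnalytic fun z => f z + g z := by
  obtain ⟨hf, C, hC⟩ := hf
  obtain ⟨hg, D, hD⟩ := hg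
  exact ⟨hf.add hg, C + D, fun z hz => (norm_add_le _ _).trans (add_le_add (hC z hz) (hD z hz))⟩

theorem IsBoundedAnalytic.mul (hf : IsBoundedAnalytic f)
    (hg : IsBoundedAnalytic g) : IsBoundedAnalytic fun z => f z * g z := by
  obtain ⟨hf, C, hC⟩ := hf
  obtain ⟨hg, D, hD⟩ := hg
  refine ⟨hf.mul hg, C * D, fun z hz => ?_⟩
  rw [norm_mul]
  exact mul_le_mul (hC z hz) (hD z hz) (norm_nonneg _) ((norm_nonneg _).trans (hC z hz))

theorem IsBoundedType.congr (hf : IsBoundedType f)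
    (h : ∀ z ∈ upperHalf, g z = f z) : IsBoundedType g := by
  obtain ⟨hd, p, q, hp, hq, hq0, hpq⟩ := hf
  exact ⟨hd.congr h, p, q, hp, hq, hq0, fun z hz => by rw [h z hz, hpq z hz]⟩

theorem IsBoundedType.mul_isBoundedAnalytic (hf : IsBoundedType f)
    (hb : IsBoundedAnalytic b) : IsBoundedType fun z => f z * b z := by
  obtain ⟨hd, p, q, hp, hq, hq0, hpq⟩ := hf
  exact ⟨hd.mul hb.1, fun z => p z * b z, q, hp.mul hb, hq, hq0,
    fun z hz => by simp only [← hpq z hz]; ring⟩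

theorem IsBoundedType.const_mul (hf : IsBoundedType f) (c : ℂ) :
    IsBoundedType fun z => c * f z :=
  (hf.mul_isBoundedAnalytic (IsBoundedAnalytic.const c)).congr fun _ _ => mul_comm _ _

theorem IsBoundedType.add (hf : IsBoundedType f) (hg : IsBoundedType g) :
    IsBoundedType fun z => f z + g z := by
  obtain ⟨hd, p, q, hp, hq, ⟨a, ha, hqa⟩, hpq⟩ := hf
  obtain ⟨hd', p', q', hp', hq', ⟨b, hb, hqb⟩, hpq'⟩ := hg
  refine ⟨hd.add hd', fun z => p z * q' z + p' z * q z, fun z => q z * q' z,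
    (hp.mul hq').add (hp'.mul hq), hq.mul hq', ?_, fun z hz => ?_⟩
  · by_contra! h
    rcases AnalyticOnNhd.eq_zero_or_eq_zero_of_mul_eq_zero
      (hq.1.analyticOnNhd isOpen_upperHalf) (hq'.1.analyticOnNhd isOpen_upperHalf) h
      isPreconnected_upperHalf with h | h
    · exact hqa (h a ha)
    · exact hqb (h b hb)
  · simp only [← hpq z hz, ← hpq' z hz]
    ring
theorem IsBoundedType.exists_norm_le_one (hf : IsBoundedType f) :
    ∃ q : ℂ → ℂ, DifferentiableOn ℂ q upperHalf ∧ (∀ z ∈ upperHalf, ‖q z‖ ≤ 1) ∧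
      (∀ z ∈ upperHalf, ‖f z * q z‖ ≤ 1) ∧ ∃ a ∈ upperHalf, q a ≠ 0 := by
  obtain ⟨-, p, q, ⟨-, C, hC⟩, ⟨hq, D, hD⟩, ⟨a, ha, hqa⟩, hpq⟩ := hf
  set M : ℝ := max 1 (max C D)
  have hM : 0 < M := zero_lt_one.trans_le (le_max_left _ _)
  have hCM : C ≤ M := (le_max_left _ _).trans (le_max_right _ _)
  have hDM : D ≤ M := (le_max_right _ _).trans (le_max_right _ _)
  have hnorm_div (x : ℂ) : ‖x / M‖ = ‖x‖ / M := by
    rw [norm_div, Complex.norm_of_nonneg hM.le]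
  refine ⟨fun z => q z / M, hq.div_const _, fun z hz => ?_, fun z hz => ?_, a, ha,
    div_ne_zero hqa (ofReal_ne_zero.2 hM.ne')⟩
  · rw [hnorm_div]
    exact div_le_one_of_le₀ ((hD z hz).trans hDM) hM.le
  · rw [← mul_div_assoc, hpq z hz, hnorm_div]
    exact div_le_one_of_le₀ ((hC z hz).trans hCM) hM.le

end BoundedType

section PhragmenLindelof

variable {H : ℂ → ℂ} {C M : ℝ} {z : ℂ}

theorem norm_le_mul_exp_of_diffContOnCl {ε : ℝ} (hC : 0 ≤ C) (hH : DiffContOnCl ℂ H upperHalf)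
    (hle : ∀ z : ℂ, 0 ≤ z.im → ‖H z‖ ≤ M * Real.exp (C * z.im))
    (hε : 0 ≤ ε) (him : ∀ᶠ y : ℝ in atTop, ‖H (I * y)‖ ≤ Real.exp (ε * y)) (hz : 0 ≤ z.im) :
    ‖H z‖ ≤ M * Real.exp (ε * z.im) := by
  have hM : 0 ≤ M := by
    have h := (norm_nonneg _).trans (hle 0 zero_im.ge)
    rwa [zero_im, mul_zero, Real.exp_zero, mul_one] at h
  let f : ℂ → ℂ := fun w => H (I * w) * exp (-ε * w)
  have hnorm (w : ℂ) : ‖f w‖ = ‖H (I * w)‖ * Real.exp (-(ε * w.re)) := by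
    rw [norm_mul, norm_exp, ← ofReal_neg, re_ofReal_mul, neg_mul]
  have hfle (w : ℂ) (hw : 0 ≤ w.re) : ‖f w‖ ≤ M * Real.exp (C * w.re) := by
    have h := hle (I * w) (by rwa [I_mul_im])
    rw [I_mul_im] at h
    rw [hnorm]
    exact (mul_le_of_le_one_right (norm_nonneg _)
      (Real.exp_le_one_iff.2 (neg_nonpos.2 (by positivity)))).trans h
  have hf : DiffContOnCl ℂ f {w | 0 < w.re} := by
    refine (hH.comp (g := fun w => I * w) (differentiable_id.const_mul I).diffContOnCl
      fun w hw => ?_).smul (differentiable_id.const_mul _).cexp.diffContOnCl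
    rwa [upperHalf, Set.mem_ofPred_eq, I_mul_im]
  have hre : (-I * z).re = z.im := by
    rw [neg_mul, neg_re, I_mul_re, neg_neg]
  have hPL := PhragmenLindelof.right_half_plane_of_bounded_on_real (C := M) hf
    ⟨1, one_lt_two, C, .of_bound M ?_⟩ ?_ (fun x => ?_) (hz.trans_eq hre.symm)
  · have hzI : I * (-I * z) = z := by linear_combination -z * I_mul_I
    rwa [hnorm, hzI, hre, Real.exp_neg, mul_inv_le_iff₀ (Real.exp_pos _)] at hPL
  · rw [eventually_inf_principal]
    refine Eventually.of_forall fun w (hw : 0 < w.re) => (hfle w hw.le).trans ?_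
    rw [Real.norm_of_nonneg (Real.exp_pos _).le, Real.rpow_one]
    gcongr
    exact re_le_norm w
  · refine isBoundedUnder_of_eventually_le (a := 1) (him.mono fun x hx => ?_)
    rw [hnorm, ofReal_re, Real.exp_neg, mul_inv_le_iff₀ (Real.exp_pos _), one_mul]
    exact hx
  · have hx : ((x : ℂ) * I).re = 0 := by rw [re_ofReal_mul, I_re, mul_zero]
    have h := hfle (x * I) hx.ge
    rwa [hx, mul_zero, Real.exp_zero, mul_one] at h

theorem norm_le_of_diffContOnCl_of_subexponential (hC : 0 ≤ C) (hH : DiffContOnCl ℂ H upperHalf)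
    (hle : ∀ z : ℂ, 0 ≤ z.im → ‖H z‖ ≤ M * Real.exp (C * z.im))
    (him : ∀ ε > 0, ∀ᶠ y : ℝ in atTop, ‖H (I * y)‖ ≤ Real.exp (ε * y)) (hz : 0 ≤ z.im) :
    ‖H z‖ ≤ M := by
  have hlim : Tendsto (fun ε : ℝ => M * Real.exp (ε * z.im)) (𝓝[>] 0) (𝓝 M) :=
    (Continuous.tendsto' (by fun_prop) _ _
      (by rw [zero_mul, Real.exp_zero, mul_one])).mono_left nhdsWithin_le_nhds
  exact ge_of_tendsto hlim (eventually_mem_nhdsWithin.mono fun ε hε =>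
    norm_le_mul_exp_of_diffContOnCl hC hH hle (le_of_lt hε) (him ε hε) hz)

theorem norm_le_one_of_subexponential (hC : 0 ≤ C) (hH : DifferentiableOn ℂ H upperHalf)
    (hle : ∀ z ∈ upperHalf, ‖H z‖ ≤ Real.exp (C * z.im))
    (him : ∀ ε > 0, ∀ᶠ y : ℝ in atTop, ‖H (I * y)‖ ≤ Real.exp (ε * y)) (hz : z ∈ upperHalf) :
    ‖H z‖ ≤ 1 := by
  have hshift : ∀ η ∈ Set.Ioo 0 z.im, ‖H z‖ ≤ Real.exp (C * η) := by
    rintro η ⟨hη, hηz⟩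
    have him_add (w : ℂ) : (w + I * η).im = w.im + η := by rw [add_im, I_mul_im, ofReal_re]
    have hmaps (w : ℂ) (hw : 0 ≤ w.im) : w + I * η ∈ upperHalf := by
      rw [upperHalf, Set.mem_ofPred_eq, him_add]
      linarith
    have hdiff : DiffContOnCl ℂ (fun w => H (w + I * η)) upperHalf := by
      refine DifferentiableOn.diffContOnCl fun w hw => ?_
      rw [upperHalf, closure_setOfPred_lt_im] at hw
      exact ((hH.differentiableAt (isOpen_upperHalf.mem_nhds (hmaps w hw))).comp w
        (by fun_prop)).differentiableWithinAt
    have h := norm_le_of_diffContOnCl_of_subexponential (z := z - I * η) (M := Real.exp (C * η))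
      hC hdiff (fun w hw => ?_) (fun ε hε => ?_) ?_
    · rwa [sub_add_cancel] at h
    · rw [← Real.exp_add, ← mul_add, add_comm η, ← him_add]
      exact hle _ (hmaps w hw)
    · filter_upwards [(tendsto_atTop_add_const_right atTop η tendsto_id).eventually
        (him (ε / 2) (half_pos hε)), eventually_ge_atTop η] with y hy hηy
      rw [← mul_add, ← ofReal_add]
      refine hy.trans (Real.exp_le_exp.2 ?_)
      rw [id]
      nlinarith
    · rw [sub_im, I_mul_im, ofReal_re]
      exact sub_nonneg.2 hηz.le
  have hlim : Tendsto (fun η : ℝ => Real.exp (C * η)) (𝓝[>] 0) (𝓝 1) :=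
    (Continuous.tendsto' (by fun_prop) _ _ (by rw [mul_zero, Real.exp_zero])).mono_left
      nhdsWithin_le_nhds
  exact ge_of_tendsto hlim (mem_of_superset (Ioo_mem_nhdsGT hz) hshift)

end PhragmenLindelof

section HardyBound

variable {G : ℂ → ℂ} {a z : ℂ} {x θ : ℝ}

theorem posLog_le_sq (hx : 0 ≤ x) : posLog x ≤ x ^ 2 := by
  rcases hx.eq_or_lt with rfl | hpos
  · rw [Real.posLog_apply, Real.log_zero, max_self]
    exact sq_nonneg 0
  · refine max_le (sq_nonneg x) ((Real.log_le_sub_one_of_pos hpos).trans ?_)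
    nlinarith [sq_nonneg (x - 1)]

theorem exp_two_mul_posLog_le (hx : 0 ≤ x) : Real.exp (2 * posLog x) ≤ 1 + x ^ 2 := by
  rw [Real.posLog_eq_log_max_one hx, mul_comm, Real.exp_mul,
    Real.exp_log (lt_max_of_lt_left one_pos), Real.rpow_two]
  rcases le_total 1 x with h | h
  · rw [max_eq_right h]
    linarith
  · rw [max_eq_left h]
    nlinarith

theorem circleIntegrable_zero_one_iff {f : ℂ → ℝ} : CircleIntegrable f 0 1 ↔
    IntegrableOn (fun θ => f (circleMap 0 1 θ)) (Set.Ioo 0 (2 * Real.pi)) :=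
  intervalIntegrable_iff_integrableOn_Ioo_of_le Real.two_pi_pos.le

theorem ne_one_of_mem_ball {ζ : ℂ} (hζ : ζ ∈ ball (0 : ℂ) 1) : ζ ≠ 1 := by
  rintro rfl
  exact (mem_ball_zero_iff.1 hζ).ne norm_one

theorem one_le_jacobian_angleToReal (ha : 0 < a.im) (hθ : θ ∈ Set.Ioo 0 (2 * Real.pi)) :
    1 ≤ 2 / a.im * (2 * a.im / ‖1 - circleMap 0 1 θ‖ ^ 2) := by
  have hpos : 0 < ‖1 - circleMap 0 1 θ‖ :=
    norm_pos_iff.2 (sub_ne_zero.2 (circleMap_ne_one hθ).symm)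
  have hle : ‖1 - circleMap 0 1 θ‖ ≤ 2 := by
    calc ‖1 - circleMap 0 1 θ‖ ≤ ‖(1 : ℂ)‖ + ‖circleMap 0 1 θ‖ := norm_sub_le _ _
      _ = 2 := by rw [norm_circleMap_zero, norm_one, abs_one, one_add_one_eq_two]
  calc 1 ≤ 2 ^ 2 / ‖1 - circleMap 0 1 θ‖ ^ 2 := by
        rw [one_le_div (by positivity)]
        gcongr
    _ = 2 / a.im * (2 * a.im / ‖1 - circleMap 0 1 θ‖ ^ 2) := by field_simp

theorem differentiableOn_comp_ofDisc (ha : a ∈ upperHalf) (hG : DifferentiableOn ℂ G upperHalf) :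
    DifferentiableOn ℂ (fun ζ => G (ofDisc a ζ)) (ball 0 1) :=
  hG.comp (fun _ hζ => (hasDerivAt_ofDisc a
    (ne_one_of_mem_ball hζ)).differentiableAt.differentiableWithinAt) fun _ => im_ofDisc_pos ha

theorem continuousOn_comp_ofDisc (ha : a ∈ upperHalf) (hG : ContinuousOn G {z | 0 ≤ z.im}) :
    ContinuousOn (fun ζ => G (ofDisc a ζ)) (closedBall 0 1 \ {1}) :=
  hG.comp (fun _ hζ => (hasDerivAt_ofDisc a hζ.2).continuousAt.continuousWithinAt)
    fun _ hζ => im_ofDisc_nonneg ha hζ.1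

theorem continuousOn_comp_angleToReal (ha : a ∈ upperHalf) (hG : ContinuousOn G {z | 0 ≤ z.im}) :
    ContinuousOn (fun θ => G (angleToReal a θ)) (Set.Ioo 0 (2 * Real.pi)) := by
  refine ((continuousOn_comp_ofDisc ha hG).comp (continuous_circleMap 0 1).continuousOn
    fun θ hθ => ⟨?_, circleMap_ne_one hθ⟩).congr fun θ _ => ?_
  · rw [mem_closedBall_zero_iff, norm_circleMap_zero, abs_one]
  · rw [Function.comp_apply, ofDisc_circleMap]

theorem circleIntegrable_sq_norm_comp_ofDisc (ha : a ∈ upperHalf)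
    (hG : ContinuousOn G {z | 0 ≤ z.im}) (hL2 : Integrable fun t : ℝ => ‖G t‖ ^ 2) :
    CircleIntegrable (fun ζ => ‖G (ofDisc a ζ)‖ ^ 2) 0 1 := by
  simp only [circleIntegrable_zero_one_iff, ofDisc_circleMap]
  refine ((integrableOn_comp_angleToReal ha hL2).const_mul (2 / a.im)).mono'
    (((continuousOn_comp_angleToReal ha hG).norm.pow 2).aestronglyMeasurable measurableSet_Ioo) ?_
  filter_upwards [ae_restrict_mem measurableSet_Ioo] with θ hθ
  rw [Real.norm_of_nonneg (by positivity), ← mul_assoc]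
  exact le_mul_of_one_le_left (by positivity) (one_le_jacobian_angleToReal ha hθ)

theorem circleIntegrable_posLog_norm_comp_ofDisc (ha : a ∈ upperHalf)
    (hG : ContinuousOn G {z | 0 ≤ z.im}) (hL2 : Integrable fun t : ℝ => ‖G t‖ ^ 2) :
    CircleIntegrable (fun ζ => posLog ‖G (ofDisc a ζ)‖) 0 1 := by
  have hsq := circleIntegrable_sq_norm_comp_ofDisc ha hG hL2
  simp only [circleIntegrable_zero_one_iff, ofDisc_circleMap] at hsq ⊢
  refine hsq.mono' ((Real.continuous_posLog.comp_continuousOn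
    (continuousOn_comp_angleToReal ha hG).norm).aestronglyMeasurable measurableSet_Ioo)
    (Eventually.of_forall fun θ => ?_)
  rw [Real.norm_of_nonneg Real.posLog_nonneg]
  exact posLog_le_sq (norm_nonneg _)

theorem poissonIntegral_sq_norm_comp_ofDisc_le (ha : a ∈ upperHalf)
    (hG : ContinuousOn G {z | 0 ≤ z.im}) (hL2 : Integrable fun t : ℝ => ‖G t‖ ^ 2)
    (hz : z ∈ upperHalf) :
    poissonIntegral 1 (fun ζ => ‖G (ofDisc a ζ)‖ ^ 2) (toDisc a z) ≤
      (∫ t : ℝ, ‖G t‖ ^ 2) / (Real.pi * z.im) := by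
  have hz' : 0 < z.im := hz
  have hint := circleIntegrable_zero_one_iff.1 <| circleIntegrable_poissonKernel_mul
    (toDisc_mem_ball ha hz) (circleIntegrable_sq_norm_comp_ofDisc ha hG hL2)
  have hle : ∫ θ in Set.Ioo 0 (2 * Real.pi), poissonKernel 0 (toDisc a z) (circleMap 0 1 θ) *
      ‖G (ofDisc a (circleMap 0 1 θ))‖ ^ 2 ≤ 2 / z.im * ∫ t : ℝ, ‖G t‖ ^ 2 := by
    rw [← integral_comp_angleToReal ha fun t : ℝ => ‖G t‖ ^ 2, ← integral_const_mul]
    refine setIntegral_mono_on hint ((integrableOn_comp_angleToReal ha hL2).const_mul _)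
      measurableSet_Ioo fun θ hθ => ?_
    have h := poissonKernel_toDisc_ofReal_le ha hz (angleToReal a θ)
    rw [toDisc_angleToReal ha hθ] at h
    rw [ofDisc_circleMap, ← mul_assoc]
    gcongr
  rw [poissonIntegral, Real.circleAverage_def,
    intervalIntegral.integral_of_le Real.two_pi_pos.le, integral_Ioc_eq_integral_Ioo, smul_eq_mul]
  calc (2 * Real.pi)⁻¹ * ∫ θ in Set.Ioo 0 (2 * Real.pi),
        poissonKernel 0 (toDisc a z) (circleMap 0 1 θ) * ‖G (ofDisc a (circleMap 0 1 θ))‖ ^ 2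
      ≤ (2 * Real.pi)⁻¹ * (2 / z.im * ∫ t : ℝ, ‖G t‖ ^ 2) := by gcongr
    _ = (∫ t : ℝ, ‖G t‖ ^ 2) / (Real.pi * z.im) := by field_simp

theorem IsBoundedType.exists_norm_le_exp_poissonIntegral_add (hG : IsBoundedType G)
    (hGc : ContinuousOn G {z | 0 ≤ z.im}) (hL2 : Integrable fun t : ℝ => ‖G t‖ ^ 2) :
    ∃ a ∈ upperHalf, ∃ C ≥ 0, ∀ z ∈ upperHalf, ‖G z‖ ≤
      Real.exp (poissonIntegral 1 (fun ζ => posLog ‖G (ofDisc a ζ)‖) (toDisc a z) + C * z.im) := by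
  obtain ⟨q, hq, hq1, hGq, a, ha, hqa⟩ := hG.exists_norm_le_one
  have ha' : 0 < a.im := ha
  have h0 : ofDisc a 0 = a := by rw [ofDisc, mul_zero, sub_zero, sub_zero, div_one]
  refine ⟨a, ha, -Real.log ‖q a‖ / a.im, div_nonneg
    (neg_nonneg.2 (Real.log_nonpos (norm_nonneg _) (hq1 a ha))) ha'.le, fun z hz => ?_⟩
  have h := norm_le_exp_poissonIntegral_add (differentiableOn_comp_ofDisc ha hG.1)
    (continuousOn_comp_ofDisc ha hGc) (differentiableOn_comp_ofDisc ha hq)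
    (fun ζ hζ => hq1 _ (im_ofDisc_pos ha hζ)) (fun ζ hζ => hGq _ (im_ofDisc_pos ha hζ))
    (by rwa [h0]) (circleIntegrable_posLog_norm_comp_ofDisc ha hGc hL2) (toDisc_mem_ball ha hz)
  rwa [ofDisc_toDisc ha (le_of_lt hz), poissonKernel_toDisc_one ha hz, h0, div_mul_eq_mul_div,
    mul_comm z.im, mul_div_right_comm] at h

/-- The linear term is removed by Phragmén–Lindelöf, applied to `G * exp (-S)` with `re S` the
Poisson integral. -/
theorem IsBoundedType.exists_norm_le_exp_poissonIntegral (hG : IsBoundedType G)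
    (hmean : meanType G ≤ 0) (hGc : ContinuousOn G {z | 0 ≤ z.im})
    (hL2 : Integrable fun t : ℝ => ‖G t‖ ^ 2) :
    ∃ a ∈ upperHalf, ∀ z ∈ upperHalf, ‖G z‖ ≤
      Real.exp (poissonIntegral 1 (fun ζ => posLog ‖G (ofDisc a ζ)‖) (toDisc a z)) := by
  obtain ⟨a, ha, C, hC, hle⟩ := hG.exists_norm_le_exp_poissonIntegral_add hGc hL2
  obtain ⟨S, hS, hSre⟩ := exists_differentiableOn_re_eq_poissonIntegral
    (circleIntegrable_posLog_norm_comp_ofDisc ha hGc hL2)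
  refine ⟨a, ha, fun z hz => ?_⟩
  have hmaps : Set.MapsTo (toDisc a) upperHalf (ball 0 1) := fun w hw => toDisc_mem_ball ha hw
  have htoDisc : DifferentiableOn ℂ (toDisc a) upperHalf :=
    (differentiableOn_id.sub_const a).div (differentiableOn_id.sub_const _)
      fun w hw => sub_conj_ne_zero ha (le_of_lt hw)
  have hnorm (w : ℂ) (hw : w ∈ upperHalf) : ‖G w * exp (-S (toDisc a w))‖ = ‖G w‖ *
      Real.exp (-poissonIntegral 1 (fun ζ => posLog ‖G (ofDisc a ζ)‖) (toDisc a w)) := by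
    rw [norm_mul, norm_exp, neg_re, hSre _ (hmaps hw)]
  have h := norm_le_one_of_subexponential hC (H := fun w => G w * exp (-S (toDisc a w)))
    (hG.1.mul (hS.comp htoDisc hmaps).neg.cexp) (fun w hw => ?_) (fun ε hε => ?_) hz
  · rwa [hnorm z hz, Real.exp_neg, mul_inv_le_iff₀ (Real.exp_pos _), one_mul] at h
  · rw [hnorm w hw, Real.exp_neg, mul_inv_le_iff₀ (Real.exp_pos _), ← Real.exp_add, add_comm]
    exact hle w hw
  · filter_upwards [meanType_le_zero_iff.1 hmean ε hε, eventually_gt_atTop 0] with y hy hy0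
    rw [hnorm _ (I_mul_mem_upperHalf hy0)]
    refine (mul_le_of_le_one_right (norm_nonneg _) ?_).trans hy
    rw [Real.exp_le_one_iff, neg_nonpos]
    exact poissonIntegral_nonneg (hmaps (I_mul_mem_upperHalf hy0)) fun _ => Real.posLog_nonneg

theorem IsBoundedType.sq_norm_le_one_add (hG : IsBoundedType G) (hmean : meanType G ≤ 0)
    (hGc : ContinuousOn G {z | 0 ≤ z.im}) (hL2 : Integrable fun t : ℝ => ‖G t‖ ^ 2)
    (hz : z ∈ upperHalf) : ‖G z‖ ^ 2 ≤ 1 + (∫ t : ℝ, ‖G t‖ ^ 2) / (Real.pi * z.im) := by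
  obtain ⟨a, ha, hle⟩ := hG.exists_norm_le_exp_poissonIntegral hmean hGc hL2
  have hw := toDisc_mem_ball ha hz
  have hsq := circleIntegrable_sq_norm_comp_ofDisc ha hGc hL2
  have hlog : CircleIntegrable (fun ζ => 2 * posLog ‖G (ofDisc a ζ)‖) 0 1 :=
    (circleIntegrable_posLog_norm_comp_ofDisc ha hGc hL2).const_smul
  have hone : CircleIntegrable (fun _ => (1 : ℝ)) 0 1 := circleIntegrable_const _ _ _
  calc ‖G z‖ ^ 2
      ≤ Real.exp (poissonIntegral 1 (fun ζ => posLog ‖G (ofDisc a ζ)‖) (toDisc a z)) ^ 2 := by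
        gcongr
        exact hle z hz
    _ = Real.exp (poissonIntegral 1 (fun ζ => 2 * posLog ‖G (ofDisc a ζ)‖) (toDisc a z)) := by
        rw [poissonIntegral_const_mul, ← Real.exp_nat_mul, Nat.cast_ofNat]
    _ ≤ poissonIntegral 1 (fun ζ => 1 + ‖G (ofDisc a ζ)‖ ^ 2) (toDisc a z) :=
        exp_poissonIntegral_le hw hlog (hone.add hsq)
          fun _ _ => exp_two_mul_posLog_le (norm_nonneg _)
    _ = 1 + poissonIntegral 1 (fun ζ => ‖G (ofDisc a ζ)‖ ^ 2) (toDisc a z) := by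
        rw [poissonIntegral_add hw hone hsq, poissonIntegral_const hw]
    _ ≤ 1 + (∫ t : ℝ, ‖G t‖ ^ 2) / (Real.pi * z.im) := by
        gcongr
        exact poissonIntegral_sq_norm_comp_ofDisc_le ha hGc hL2 hz

/-- The additive constant is removed by scaling `G`. -/
theorem IsBoundedType.sq_norm_le (hG : IsBoundedType G) (hmean : meanType G ≤ 0)
    (hGc : ContinuousOn G {z | 0 ≤ z.im}) (hL2 : Integrable fun t : ℝ => ‖G t‖ ^ 2)
    (hz : z ∈ upperHalf) : ‖G z‖ ^ 2 ≤ (∫ t : ℝ, ‖G t‖ ^ 2) / (Real.pi * z.im) := by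
  set A := (∫ t : ℝ, ‖G t‖ ^ 2) / (Real.pi * z.im)
  have hscale : ∀ c : ℝ, 0 < c → ‖G z‖ ^ 2 ≤ (c ^ 2)⁻¹ + A := fun c hc => by
    have hnorm (w : ℂ) : ‖c * G w‖ ^ 2 = c ^ 2 * ‖G w‖ ^ 2 := by
      rw [norm_mul, Complex.norm_of_nonneg hc.le, mul_pow]
    have h := (hG.const_mul c).sq_norm_le_one_add (meanType_const_mul_le_zero hmean c)
      (continuousOn_const.mul hGc) (by simp only [hnorm]; exact hL2.const_mul _) hz
    simp only [hnorm, integral_const_mul, mul_div_assoc] at h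
    refine le_of_mul_le_mul_left (h.trans_eq ?_) (pow_pos hc 2)
    rw [mul_add, mul_inv_cancel₀ (pow_pos hc 2).ne']
  have hlim : Tendsto (fun c : ℝ => (c ^ 2)⁻¹ + A) atTop (𝓝 A) := by
    simpa only [zero_add, Pi.inv_apply] using
      (tendsto_pow_atTop two_ne_zero).inv_tendsto_atTop.add_const A
  exact ge_of_tendsto hlim ((eventually_gt_atTop 0).mono hscale)

end HardyBound

section HardySpace

variable {G H h : ℂ → ℂ} {B R s : ℝ} {c : ℂ} {w : ℝ}

theorem norm_integral_vertical_le (hB0 : 0 ≤ B) (hR : 0 < R) (hs : |s| = R)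
    (hB : ∀ z ∈ upperHalf, R ≤ ‖z‖ → ‖h z‖ ≤ B * z.im ^ (-(1 / 2) : ℝ) / ‖z‖) :
    ‖∫ y in (0 : ℝ)..R, h (s + y * I)‖ ≤ 2 * B * R ^ (-(1 / 2) : ℝ) := by
  have hbound : ∀ y ∈ Set.Ioc 0 R, ‖h (s + y * I)‖ ≤ B / R * y ^ (-(1 / 2) : ℝ) := fun y hy => by
    have him : ((s : ℂ) + y * I).im = y := by simp
    have hnorm : R ≤ ‖(s : ℂ) + y * I‖ := by
      simpa [hs] using abs_re_le_norm ((s : ℂ) + y * I)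
    have hle := hB _ (show 0 < ((s : ℂ) + y * I).im from him.symm ▸ hy.1) hnorm
    rw [him] at hle
    refine hle.trans ?_
    have hy0 := hy.1
    rw [div_mul_eq_mul_div]
    gcongr
  have hint : IntervalIntegrable (fun y : ℝ => B / R * y ^ (-(1 / 2) : ℝ)) volume 0 R :=
    (intervalIntegral.intervalIntegrable_rpow' (by norm_num)).const_mul _
  refine (intervalIntegral.norm_integral_le_of_norm_le hR.le
    (Eventually.of_forall hbound) hint).trans_eq ?_
  have hexp : (-(1 / 2) + 1 : ℝ) = 1 + -(1 / 2) := add_comm _ _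
  rw [intervalIntegral.integral_const_mul, integral_rpow (Or.inl (by norm_num)),
    Real.zero_rpow (by norm_num), sub_zero, hexp, Real.rpow_add hR, Real.rpow_one]
  field_simp
  norm_num

theorem norm_integral_horizontal_le (hB0 : 0 ≤ B) (hR : 0 < R)
    (hB : ∀ z ∈ upperHalf, R ≤ ‖z‖ → ‖h z‖ ≤ B * z.im ^ (-(1 / 2) : ℝ) / ‖z‖) :
    ‖∫ x in (-R)..R, h (x + R * I)‖ ≤ 2 * B * R ^ (-(1 / 2) : ℝ) := by
  have hbound : ∀ x ∈ Set.uIoc (-R) R, ‖h (x + R * I)‖ ≤ B * R ^ (-(1 / 2) : ℝ) / R :=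
    fun x _ => by
      have him : ((x : ℂ) + R * I).im = R := by simp
      have hnorm : R ≤ ‖(x : ℂ) + R * I‖ := by
        simpa [abs_of_pos hR] using abs_im_le_norm ((x : ℂ) + R * I)
      have hle := hB _ (show 0 < ((x : ℂ) + R * I).im from him.symm ▸ hR) hnorm
      rw [him] at hle
      refine hle.trans ?_
      gcongr
  refine (intervalIntegral.norm_integral_le_of_norm_le_const hbound).trans_eq ?_
  rw [sub_neg_eq_add, abs_of_pos (add_pos hR hR)]
  field_simp
  ring

theorem integral_symm_interval_eq (hc : ContinuousOn h {z | 0 ≤ z.im})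
    (hd : DifferentiableOn ℂ h upperHalf) (hR : 0 < R) :
    ∫ x in (-R)..R, h x = (∫ x in (-R)..R, h (x + R * I)) -
      I • (∫ y in (0 : ℝ)..R, h (R + y * I)) +
      I • ∫ y in (0 : ℝ)..R, h ((-R : ℝ) + y * I) := by
  have him : ((R : ℂ) + R * I).im = R := by simp
  have hrect := integral_boundary_rect_eq_zero_of_continuousOn_of_differentiableOn h
    (-R : ℝ) (R + R * I) (hc.mono fun z hz => ?_) (hd.mono fun z hz => ?_)
  · simp only [ofReal_im, him, add_re, ofReal_re, re_ofReal_mul, I_re, mul_zero, add_zero,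
      ofReal_zero, zero_mul] at hrect
    linear_combination hrect
  · have him_mem := (mem_reProdIm.1 hz).2
    rw [ofReal_im, him, Set.uIcc_of_le hR.le] at him_mem
    exact him_mem.1
  · have him_mem := (mem_reProdIm.1 hz).2
    rw [ofReal_im, him, min_eq_left hR.le] at him_mem
    exact him_mem.1

theorem integral_eq_zero_of_decay (hc : ContinuousOn h {z | 0 ≤ z.im})
    (hd : DifferentiableOn ℂ h upperHalf) (hint : Integrable fun t : ℝ => h t) (hB0 : 0 ≤ B)
    {R₀ : ℝ} (hB : ∀ z ∈ upperHalf, R₀ ≤ ‖z‖ → ‖h z‖ ≤ B * z.im ^ (-(1 / 2) : ℝ) / ‖z‖) :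
    ∫ t : ℝ, h t = 0 := by
  have hbound : ∀ᶠ R : ℝ in atTop,
      ‖∫ x in (-R)..R, h x‖ ≤ 6 * B * R ^ (-(1 / 2) : ℝ) := by
    filter_upwards [eventually_ge_atTop R₀, eventually_gt_atTop 0] with R hR hR0
    have hBR : ∀ z ∈ upperHalf, R ≤ ‖z‖ → ‖h z‖ ≤ B * z.im ^ (-(1 / 2) : ℝ) / ‖z‖ :=
      fun z hz hRz => hB z hz (hR.trans hRz)
    have hright := norm_integral_vertical_le hB0 hR0 (abs_of_pos hR0) hBR
    have hleft := norm_integral_vertical_le hB0 hR0 ((abs_neg R).trans (abs_of_pos hR0)) hBR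
    have htop := norm_integral_horizontal_le hB0 hR0 hBR
    rw [integral_symm_interval_eq hc hd hR0]
    refine (norm_add_le _ _).trans ((add_le_add_left (norm_sub_le _ _) _).trans ?_)
    rw [norm_smul, norm_smul, norm_I, one_mul, one_mul]
    linarith
  have hlim : Tendsto (fun R : ℝ => 6 * B * R ^ (-(1 / 2) : ℝ)) atTop (𝓝 0) := by
    simpa only [mul_zero] using (tendsto_rpow_neg_atTop one_half_pos).const_mul (6 * B)
  exact tendsto_nhds_unique
    (intervalIntegral_tendsto_integral hint tendsto_neg_atTop_atBot tendsto_id)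
    (squeeze_zero_norm' hbound hlim)

theorem sq_norm_ofReal_sub (t : ℝ) (c : ℂ) : ‖(t : ℂ) - c‖ ^ 2 = (t - c.re) ^ 2 + c.im ^ 2 := by
  rw [← normSq_eq_norm_sq, normSq_apply, sub_re, sub_im, ofReal_re, ofReal_im]
  ring

theorem ofReal_sub_ne_zero (hc : c.im ≠ 0) (t : ℝ) : (t : ℂ) - c ≠ 0 :=
  sub_ne_zero.2 fun h => hc (h ▸ ofReal_im t)

theorem integrable_inv_sq_add_sq (u : ℝ) {v : ℝ} (hv : v ≠ 0) :
    Integrable fun t : ℝ => ((t - u) ^ 2 + v ^ 2)⁻¹ := by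
  refine (((integrable_inv_one_add_sq.comp_div hv).comp_sub_right u).const_mul (v ^ 2)⁻¹).congr
    (Eventually.of_forall fun t => ?_)
  field_simp
  ring

theorem integral_inv_sq_add_one (u : ℝ) : ∫ t : ℝ, ((t - u) ^ 2 + 1)⁻¹ = Real.pi := by
  rw [integral_sub_right_eq_self (fun t : ℝ => (t ^ 2 + 1)⁻¹) u]
  simp only [add_comm _ (1 : ℝ), integral_univ_inv_one_add_sq]

theorem memLp_inv_ofReal_sub (hc : c.im ≠ 0) :
    MemLp (fun t : ℝ => ((t : ℂ) - c)⁻¹) 2 volume := by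
  have hcont : Continuous fun t : ℝ => ((t : ℂ) - c)⁻¹ :=
    Continuous.inv₀ (by fun_prop) (ofReal_sub_ne_zero hc)
  rw [memLp_two_iff_integrable_sq_norm hcont.aestronglyMeasurable]
  simpa only [norm_inv, inv_pow, sq_norm_ofReal_sub] using integrable_inv_sq_add_sq c.re hc

/-- The Hardy class `H²` of the upper half-plane, restricted to functions continuous up to the real
line: the boundary function is square integrable, and the growth at the boundary is the one that
point evaluations on `H²` allow. -/
structure IsHardy (G : ℂ → ℂ) : Prop where
  continuousOn : ContinuousOn G {z | 0 ≤ z.im}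
  differentiableOn : DifferentiableOn ℂ G upperHalf
  memLp : MemLp (fun t : ℝ => G t) 2 volume
  exists_sq_norm_mul_im_le : ∃ M : ℝ, ∀ z ∈ upperHalf, ‖G z‖ ^ 2 * z.im ≤ M

theorem IsHardy.sub (hG : IsHardy G) (hH : IsHardy H) : IsHardy fun z => G z - H z where
  continuousOn := hG.continuousOn.sub hH.continuousOn
  differentiableOn := hG.differentiableOn.sub hH.differentiableOn
  memLp := hG.memLp.sub hH.memLp
  exists_sq_norm_mul_im_le := by
    obtain ⟨M, hM⟩ := hG.exists_sq_norm_mul_im_le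
    obtain ⟨N, hN⟩ := hH.exists_sq_norm_mul_im_le
    refine ⟨2 * (M + N), fun z hz => ?_⟩
    have hz0 : 0 < z.im := hz
    calc ‖G z - H z‖ ^ 2 * z.im ≤ (‖G z‖ + ‖H z‖) ^ 2 * z.im := by
          gcongr
          exact norm_sub_le _ _
      _ ≤ 2 * (‖G z‖ ^ 2 + ‖H z‖ ^ 2) * z.im := by
          gcongr
          exact add_sq_le
      _ ≤ 2 * (M + N) := by linarith [hM z hz, hN z hz]

theorem isHardy_const_mul_inv_sub (a : ℂ) (hc : c.im < 0) : IsHardy fun z => a * (z - c)⁻¹ := by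
  have him (z : ℂ) : z.im - c.im ≤ ‖z - c‖ := by
    simpa only [sub_im] using (le_abs_self _).trans (abs_im_le_norm (z - c))
  have hne {z : ℂ} (hz : 0 ≤ z.im) : z - c ≠ 0 := norm_pos_iff.1 (by linarith [him z])
  refine ⟨continuousOn_const.mul (ContinuousOn.inv₀ (by fun_prop) fun z hz => hne hz),
    (differentiableOn_const a).mul (DifferentiableOn.inv (by fun_prop) fun z hz => hne hz.le),
    (memLp_inv_ofReal_sub hc.ne).const_mul a, ‖a‖ ^ 2 / -c.im, fun z hz => ?_⟩
  have hz0 : 0 < z.im := hz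
  have hpos : 0 < ‖z - c‖ := norm_pos_iff.2 (hne hz0.le)
  rw [norm_mul, norm_inv, mul_pow, inv_pow, mul_assoc, div_eq_mul_inv]
  gcongr
  rw [inv_mul_le_iff₀ (by positivity), ← div_eq_mul_inv, le_div_iff₀ (by linarith)]
  calc z.im * -c.im ≤ (z.im - c.im) ^ 2 := by nlinarith
    _ ≤ ‖z - c‖ ^ 2 := pow_le_pow_left₀ (by linarith) (him z) 2

theorem IsHardy.exists_norm_le (hG : IsHardy G) :
    ∃ M, 0 ≤ M ∧ ∀ z ∈ upperHalf, ‖G z‖ ≤ M * z.im ^ (-(1 / 2) : ℝ) := by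
  obtain ⟨M, hM⟩ := hG.exists_sq_norm_mul_im_le
  refine ⟨√M, Real.sqrt_nonneg M, fun z hz => ?_⟩
  have hz0 : 0 < z.im := hz
  rw [Real.rpow_neg hz0.le, ← Real.sqrt_eq_rpow, ← div_eq_mul_inv, ← Real.sqrt_div' _ hz0.le]
  exact Real.le_sqrt_of_sq_le ((le_div_iff₀ hz0).2 (hM z hz))

theorem dslope_eq_div (hw : G w = 0) {z : ℂ} (hz : z ≠ w) : dslope G w z = G z / (z - w) := by
  rw [dslope_of_ne _ hz, slope_def_field, hw, sub_zero]

theorem IsHardy.continuousOn_dslope (hG : IsHardy G) (hGw : DifferentiableAt ℂ G w) :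
    ContinuousOn (dslope G w) {z | 0 ≤ z.im} := fun z hz => by
  rcases eq_or_ne z w with rfl | hzw
  · exact (continuousAt_dslope_same.2 hGw).continuousWithinAt
  · exact (continuousWithinAt_dslope_of_ne hzw).2 (hG.continuousOn z hz)

theorem dslope_ofReal_ae_eq (hw : G w = 0) :
    (fun t : ℝ => dslope G w t) =ᵐ[volume] fun t : ℝ => G t / (t - w) := by
  filter_upwards [Measure.ae_ne volume w] with t ht
  exact dslope_eq_div hw (ofReal_injective.ne ht)

theorem IsHardy.integrable_dslope (hG : IsHardy G) (hGw : DifferentiableAt ℂ G w) (hw : G w = 0) :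
    Integrable fun t : ℝ => dslope G w t := by
  have hcont : Continuous fun t : ℝ => dslope G w t := (hG.continuousOn_dslope hGw).comp_continuous
    continuous_ofReal fun t => (ofReal_im t).ge
  have him : (w - I : ℂ).im ≠ 0 := by simp
  refine hcont.locallyIntegrable.integrable_of_isBigO_cocompact
    (g := fun t : ℝ => G t * ((t : ℂ) - (w - I))⁻¹) ?_
    ((hG.memLp.integrable_mul (memLp_inv_ofReal_sub him)).integrableAtFilter _)
  refine Asymptotics.IsBigO.of_bound 2 ?_
  have hfar : ∀ᶠ t : ℝ in cocompact ℝ, t ∉ closedBall w 1 :=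
    (isCompact_closedBall w 1).compl_mem_cocompact
  filter_upwards [hfar] with t ht
  have hdist : 1 < ‖(t : ℂ) - w‖ := by
    rwa [← ofReal_sub, norm_real, ← dist_eq_norm, ← not_le]
  have hne : (t : ℂ) ≠ w := sub_ne_zero.1 (norm_pos_iff.1 (one_pos.trans hdist))
  have hle : ‖(t : ℂ) - (w - I)‖ ≤ 2 * ‖(t : ℂ) - w‖ := by
    rw [← sub_add]
    linarith [norm_add_le ((t : ℂ) - w) I, norm_I]
  rw [dslope_eq_div hw hne, norm_div, norm_mul, norm_inv,
    div_le_iff₀ (one_pos.trans hdist)]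
  have hpos := norm_pos_iff.2 (ofReal_sub_ne_zero him t)
  calc ‖G t‖ = ‖G t‖ * ‖(t : ℂ) - (w - I)‖⁻¹ * ‖(t : ℂ) - (w - I)‖ := by
        rw [inv_mul_cancel_right₀ hpos.ne']
    _ ≤ ‖G t‖ * ‖(t : ℂ) - (w - I)‖⁻¹ * (2 * ‖(t : ℂ) - w‖) := by gcongr
    _ = _ := by ring

theorem IsHardy.integrable_div_sub (hG : IsHardy G) (hGw : DifferentiableAt ℂ G w) (hw : G w = 0) :
    Integrable fun t : ℝ => G t / (t - w) :=
  (hG.integrable_dslope hGw hw).congr (dslope_ofReal_ae_eq hw)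

/-- Cauchy's theorem for `G / (z - w)`, whose singularity at `w` is removable. -/
theorem IsHardy.integral_div_sub_eq_zero (hG : IsHardy G) (hGw : DifferentiableAt ℂ G w)
    (hw : G w = 0) : ∫ t : ℝ, G t / (t - w) = 0 := by
  have hne {z : ℂ} (hz : z ∈ upperHalf) : z ≠ w := fun h => by
    simp [upperHalf, h] at hz
  have hdiff : DifferentiableOn ℂ (dslope G w) upperHalf := fun z hz =>
    (differentiableWithinAt_dslope_of_ne (hne hz)).2 (hG.differentiableOn z hz)
  obtain ⟨M, hM0, hM⟩ := hG.exists_norm_le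
  rw [← integral_congr_ae (dslope_ofReal_ae_eq hw)]
  refine integral_eq_zero_of_decay (hG.continuousOn_dslope hGw) hdiff
    (hG.integrable_dslope hGw hw) (mul_nonneg hM0 zero_le_two)
    (R₀ := 2 * ‖(w : ℂ)‖) fun z hz hR => ?_
  have hz0 : 0 < ‖z‖ := norm_pos_iff.2 fun h => by simp [upperHalf, h] at hz
  have hsub : ‖z‖ / 2 ≤ ‖z - w‖ := by linarith [norm_sub_norm_le z w]
  rw [dslope_eq_div hw (hne hz), norm_div]
  calc ‖G z‖ / ‖z - w‖ ≤ ‖G z‖ / (‖z‖ / 2) := by gcongr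
    _ ≤ M * z.im ^ (-(1 / 2) : ℝ) / (‖z‖ / 2) := by
        gcongr
        exact hM z hz
    _ = M * 2 * z.im ^ (-(1 / 2) : ℝ) / ‖z‖ := by ring

end HardySpace

section HermiteBiehler

variable {E F f g : ℂ → ℂ} {z : ℂ}

theorem starFn_ofReal (f : ℂ → ℂ) (t : ℝ) : starFn f t = conj (f t) := by
  rw [starFn, conj_ofReal]

theorem starFn_starFn (f : ℂ → ℂ) : starFn (starFn f) = f := by
  funext z
  simp only [starFn, conj_conj]

theorem differentiable_starFn (hf : Differentiable ℂ f) : Differentiable ℂ (starFn f) :=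
  fun z => by simpa only [conj_conj] using! (hf (conj z)).conj_conj

theorem tendsto_ofReal_nhdsNE (x : ℝ) :
    Tendsto (fun s : ℝ => (s : ℂ)) (𝓝[≠] x) (𝓝[≠] (x : ℂ)) :=
  continuous_ofReal.continuousWithinAt.tendsto_nhdsWithin fun _ hs => ofReal_injective.ne hs

theorem IsHermiteBiehler.ne_zero (hE : IsHermiteBiehler E) (hz : z ∈ upperHalf) : E z ≠ 0 :=
  norm_pos_iff.1 ((norm_nonneg _).trans_lt (hE.norm_lt z hz))

theorem IsHermiteBiehler.mul (hE : IsHermiteBiehler E) (hF : IsHermiteBiehler F) :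
    IsHermiteBiehler fun z => E z * F z where
  entire := hE.entire.mul hF.entire
  norm_lt z hz := by
    rw [norm_mul, norm_mul]
    exact mul_lt_mul'' (hE.norm_lt z hz) (hF.norm_lt z hz) (norm_nonneg _) (norm_nonneg _)

theorem IsHermiteBiehler.norm_starFn_div_le (hE : IsHermiteBiehler E) (hz : z ∈ upperHalf) :
    ‖starFn E z / E z‖ ≤ 1 := by
  rw [norm_div, starFn, norm_conj]
  exact div_le_one_of_le₀ (hE.norm_lt z hz).le (norm_nonneg _)

theorem IsHermiteBiehler.isBoundedAnalytic_starFn_div (hE : IsHermiteBiehler E) :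
    IsBoundedAnalytic fun z => starFn E z / E z :=
  ⟨(differentiable_starFn hE.entire).differentiableOn.div hE.entire.differentiableOn
    fun _ hz => hE.ne_zero hz, 1, fun _ hz => hE.norm_starFn_div_le hz⟩

theorem IsHermiteBiehler.eventually_ne_zero (hE : IsHermiteBiehler E) (z : ℂ) :
    ∀ᶠ w in 𝓝[≠] z, E w ≠ 0 := by
  have hI : I ∈ upperHalf := by simp [upperHalf]
  have hcodisc := (hE.entire.differentiableOn.analyticOnNhd
    isOpen_univ).preimage_zero_mem_codiscrete (hE.ne_zero hI)
  have hdisj := mem_codiscrete.1 hcodisc z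
  rwa [disjoint_principal_right, compl_compl] at hdisj

theorem IsHermiteBiehler.ae_ne_zero (hE : IsHermiteBiehler E) : ∀ᵐ t : ℝ, E t ≠ 0 := by
  have hcodisc : {t : ℝ | E t ≠ 0} ∈ codiscrete ℝ := mem_codiscrete.2 fun t => by
    rw [disjoint_principal_right, compl_compl]
    exact (tendsto_ofReal_nhdsNE t).eventually (hE.eventually_ne_zero t)
  have hae := ae_restrict_le_codiscreteWithin (μ := volume) MeasurableSet.univ hcodisc
  rwa [Measure.restrict_univ] at hae

end HermiteBiehler

section MemH

variable {E F f g : ℂ → ℂ} {z : ℂ}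

theorem measurable_div_ofReal (hE : Differentiable ℂ E) (hf : Differentiable ℂ f) :
    Measurable fun t : ℝ => f t / E t :=
  (hf.continuous.comp continuous_ofReal).measurable.div
    (hE.continuous.comp continuous_ofReal).measurable

theorem MemH.memLp (hE : IsHermiteBiehler E) (hf : MemH E f) :
    MemLp (fun t : ℝ => f t / E t) 2 volume :=
  (memLp_two_iff_integrable_sq_norm
    (measurable_div_ofReal hE.entire hf.entire).aestronglyMeasurable).2 hf.sq_integrable

theorem MemH.star (hf : MemH E f) : MemH E (starFn f) where
  entire := differentiable_starFn hf.entire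
  sq_integrable := by simpa only [norm_div, starFn_ofReal, norm_conj] using hf.sq_integrable
  boundedType := hf.boundedType_star
  meanType_le := hf.meanType_star_le
  boundedType_star := by simpa only [starFn_starFn] using hf.boundedType
  meanType_star_le := by simpa only [starFn_starFn] using hf.meanType_le

theorem MemH.add (hE : IsHermiteBiehler E) (hf : MemH E f) (hg : MemH E g) :
    MemH E fun z => f z + g z where
  entire := hf.entire.add hg.entire
  sq_integrable := by
    have hadd := (hf.memLp hE).add (hg.memLp hE)
    simpa only [add_div] using! (memLp_two_iff_integrable_sq_norm hadd.1).1 hadd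
  boundedType := by simpa only [add_div] using hf.boundedType.add hg.boundedType
  meanType_le := by simpa only [add_div] using meanType_add_le_zero hf.meanType_le hg.meanType_le
  boundedType_star := by
    simpa only [starFn, map_add, add_div] using hf.boundedType_star.add hg.boundedType_star
  meanType_star_le := by
    simpa only [starFn, map_add, add_div] using
      meanType_add_le_zero hf.meanType_star_le hg.meanType_star_le

theorem MemH.const_mul (hf : MemH E f) (c : ℂ) : MemH E fun z => c * f z where
  entire := hf.entire.const_mul c
  sq_integrable := by
    simpa only [mul_div_assoc, norm_mul, mul_pow] using hf.sq_integrable.const_mul (‖c‖ ^ 2)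
  boundedType := by simpa only [mul_div_assoc] using hf.boundedType.const_mul c
  meanType_le := by
    simpa only [mul_div_assoc] using meanType_const_mul_le_zero hf.meanType_le c
  boundedType_star := by
    simpa only [starFn, map_mul, mul_div_assoc] using hf.boundedType_star.const_mul (conj c)
  meanType_star_le := by
    simpa only [starFn, map_mul, mul_div_assoc] using
      meanType_const_mul_le_zero hf.meanType_star_le (conj c)

theorem MemH.mul_left (hF : IsHermiteBiehler F) (hf : MemH E f) :
    MemH (fun z => E z * F z) fun z => F z * f z := by
  have hcancel {z : ℂ} (hz : F z ≠ 0) : F z * f z / (E z * F z) = f z / E z := by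
    rw [mul_comm (F z), mul_div_mul_right _ _ hz]
  have hstar (z : ℂ) : starFn (fun z => F z * f z) z / (E z * F z) =
      starFn f z / E z * (starFn F z / F z) := by
    rw [div_mul_div_comm, mul_comm (starFn f z), starFn, map_mul, starFn, starFn]
  refine ⟨hF.entire.mul hf.entire, hf.sq_integrable.congr ?_,
    hf.boundedType.congr fun z hz => hcancel (hF.ne_zero hz),
    meanType_le_zero_of_norm_le hf.meanType_le fun z hz => by rw [hcancel (hF.ne_zero hz)],
    (hf.boundedType_star.mul_isBoundedAnalytic hF.isBoundedAnalytic_starFn_div).congr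
      fun z _ => hstar z, meanType_le_zero_of_norm_le hf.meanType_star_le fun z hz => ?_⟩
  · filter_upwards [hF.ae_ne_zero] with t ht
    rw [hcancel ht]
  · rw [hstar, norm_mul]
    exact mul_le_of_le_one_right (norm_nonneg _) (hF.norm_starFn_div_le hz)

theorem normH_nonneg (E f : ℂ → ℂ) : 0 ≤ normH E f := Real.sqrt_nonneg _

theorem normH_sq (E f : ℂ → ℂ) : normH E f ^ 2 = ∫ t : ℝ, ‖f t / E t‖ ^ 2 :=
  Real.sq_sqrt (integral_nonneg fun _ => sq_nonneg _)

theorem normH_starFn (E f : ℂ → ℂ) : normH E (starFn f) = normH E f := by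
  simp only [normH, norm_div, starFn_ofReal, norm_conj]

end MemH

section BoundaryExtension

variable {E f q : ℂ → ℂ} {z : ℂ}

/-- A pole of order `m` at `x` makes `‖q‖ ^ 2` at least of order `|s - x| ^ (-2 * m)` near `x`. -/
theorem meromorphicOrderAt_nonneg_of_locallyIntegrable_sq {x : ℝ} (hq : MeromorphicAt q x)
    (hint : LocallyIntegrable fun s : ℝ => ‖q s‖ ^ 2) : 0 ≤ meromorphicOrderAt q x := by
  by_contra! hneg
  obtain ⟨n, hn⟩ := WithTop.ne_top_iff_exists.1 hneg.ne_top
  have hn0 : n < 0 := by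
    rw [← hn] at hneg
    exact_mod_cast hneg
  obtain ⟨g, hg, hgx, hqg⟩ := (meromorphicOrderAt_eq_int_iff hq).1 hn.symm
  have hgx' : 0 < ‖g x‖ := norm_pos_iff.2 hgx
  have hg_ge : ∀ᶠ z in 𝓝[≠] (x : ℂ), ‖g x‖ / 2 < ‖g z‖ :=
    (hg.continuousAt.norm.eventually_const_lt (half_lt_self hgx')).filter_mono nhdsWithin_le_nhds
  have hnear : ∀ᶠ s : ℝ in 𝓝[≠] x, s ∈ ball x 1 :=
    nhdsWithin_le_nhds (Metric.ball_mem_nhds x one_pos)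
  have hO : (fun s : ℝ => (s - x)⁻¹) =O[𝓝[≠] x] fun s : ℝ => ‖q s‖ ^ 2 := by
    refine Asymptotics.IsBigO.of_bound ((‖g x‖ / 2) ^ 2)⁻¹ ?_
    filter_upwards [(tendsto_ofReal_nhdsNE x).eventually hqg,
      (tendsto_ofReal_nhdsNE x).eventually hg_ge, hnear, self_mem_nhdsWithin] with s hs hgs hs1 hsx
    have hpos : 0 < |s - x| := abs_pos.2 (sub_ne_zero.2 hsx)
    have hpow : |s - x|⁻¹ ≤ (|s - x| ^ n) ^ 2 := by
      rw [← zpow_natCast, ← zpow_mul, ← zpow_neg_one]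
      exact zpow_le_zpow_right_of_le_one₀ hpos (le_of_lt hs1) (by push_cast; omega)
    rw [hs, norm_smul, norm_zpow, ← ofReal_sub, norm_real, norm_inv, Real.norm_eq_abs,
      Real.norm_of_nonneg (sq_nonneg _), mul_pow, inv_mul_eq_div, le_div_iff₀ (by positivity)]
    gcongr
  have hsub : IntervalIntegrable (fun s : ℝ => ‖q s‖ ^ 2) volume x (x + 1) :=
    (hint.integrableOn_isCompact isCompact_uIcc).intervalIntegrable
  exact not_intervalIntegrable_of_sub_inv_isBigO_punctured hO (by simp) (by simp) hsub

/-- The quotient `f / E` with its removable singularities filled in. -/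
def quotient (E f : ℂ → ℂ) : ℂ → ℂ := toMeromorphicNFOn (fun z => f z / E z) Set.univ

theorem meromorphicOn_div (hE : Differentiable ℂ E) (hf : Differentiable ℂ f) :
    MeromorphicOn (fun z => f z / E z) Set.univ := fun z _ =>
  (hf.analyticAt z).meromorphicAt.fun_div (hE.analyticAt z).meromorphicAt

theorem quotient_of_ne_zero (hE : Differentiable ℂ E) (hf : Differentiable ℂ f) (hz : E z ≠ 0) :
    quotient E f z = f z / E z := by
  rw [quotient, toMeromorphicNFOn_eq_toMeromorphicNFAt (meromorphicOn_div hE hf) (Set.mem_univ z),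
    toMeromorphicNFAt_eq_self.2 ((hf.analyticAt z).fun_div (hE.analyticAt z) hz).meromorphicNFAt]

theorem MemH.analyticAt_quotient_ofReal (hE : IsHermiteBiehler E) (hf : MemH E f) (x : ℝ) :
    AnalyticAt ℂ (quotient E f) x := by
  have hmer := meromorphicOn_div hE.entire hf.entire
  have hnf : MeromorphicNFAt (quotient E f) x :=
    meromorphicNFOn_toMeromorphicNFOn _ _ (Set.mem_univ _)
  rw [← hnf.meromorphicOrderAt_nonneg_iff_analyticAt, quotient,
    meromorphicOrderAt_toMeromorphicNFOn hmer (Set.mem_univ _)]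
  exact meromorphicOrderAt_nonneg_of_locallyIntegrable_sq (hmer _ (Set.mem_univ _))
    hf.sq_integrable.locallyIntegrable

theorem MemH.quotient_ofReal_mul (hE : IsHermiteBiehler E) (hf : MemH E f) (t : ℝ) :
    quotient E f t * E t = f t := by
  have hmul : Tendsto (fun z => quotient E f z * E z) (𝓝[≠] (t : ℂ)) (𝓝 (quotient E f t * E t)) :=
    ((hf.analyticAt_quotient_ofReal hE t).continuousAt.mul
      hE.entire.continuous.continuousAt).tendsto.mono_left nhdsWithin_le_nhds
  have hf_lim : Tendsto f (𝓝[≠] (t : ℂ)) (𝓝 (f t)) :=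
    hf.entire.continuous.continuousAt.tendsto.mono_left nhdsWithin_le_nhds
  refine tendsto_nhds_unique hmul (hf_lim.congr' ?_)
  filter_upwards [hE.eventually_ne_zero t] with z hz
  rw [quotient_of_ne_zero hE.entire hf.entire hz, div_mul_cancel₀ _ hz]

theorem MemH.continuousOn_quotient (hE : IsHermiteBiehler E) (hf : MemH E f) :
    ContinuousOn (quotient E f) {z | 0 ≤ z.im} := fun z hz => by
  rcases (show 0 ≤ z.im from hz).eq_or_lt with him | him
  · obtain ⟨x, rfl⟩ : ∃ x : ℝ, (x : ℂ) = z := ⟨z.re, Complex.ext rfl him⟩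
    exact (hf.analyticAt_quotient_ofReal hE x).continuousAt.continuousWithinAt
  · have hcont : ContinuousAt (fun z => f z / E z) z :=
      hf.entire.continuous.continuousAt.div hE.entire.continuous.continuousAt (hE.ne_zero him)
    refine (hcont.congr ?_).continuousWithinAt
    filter_upwards [hE.entire.continuous.continuousAt.eventually_ne (hE.ne_zero him)] with w hw
    exact (quotient_of_ne_zero hE.entire hf.entire hw).symm

theorem MemH.quotient_ae_eq (hE : IsHermiteBiehler E) (hf : MemH E f) :
    (fun t : ℝ => quotient E f t) =ᵐ[volume] fun t : ℝ => f t / E t := by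
  filter_upwards [hE.ae_ne_zero] with t ht
  exact quotient_of_ne_zero hE.entire hf.entire ht

theorem MemH.memLp_quotient (hE : IsHermiteBiehler E) (hf : MemH E f) :
    MemLp (fun t : ℝ => quotient E f t) 2 volume :=
  (hf.memLp hE).ae_eq (hf.quotient_ae_eq hE).symm

theorem MemH.sq_norm_quotient_le (hE : IsHermiteBiehler E) (hf : MemH E f) (hz : z ∈ upperHalf) :
    ‖quotient E f z‖ ^ 2 ≤ normH E f ^ 2 / (Real.pi * z.im) := by
  have heq {w : ℂ} (hw : w ∈ upperHalf) : quotient E f w = f w / E w :=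
    quotient_of_ne_zero hE.entire hf.entire (hE.ne_zero hw)
  have hint : ∫ t : ℝ, ‖quotient E f t‖ ^ 2 = normH E f ^ 2 := by
    rw [normH_sq]
    refine integral_congr_ae ((hf.quotient_ae_eq hE).mono fun t ht => ?_)
    beta_reduce at ht ⊢
    rw [ht]
  have hL2 := hf.memLp_quotient hE
  rw [← hint]
  exact (hf.boundedType.congr fun w hw => heq hw).sq_norm_le
    (meanType_le_zero_of_norm_le hf.meanType_le fun w hw => (congrArg norm (heq hw)).le)
    (hf.continuousOn_quotient hE) ((memLp_two_iff_integrable_sq_norm hL2.1).1 hL2) hz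

theorem MemH.isHardy_quotient (hE : IsHermiteBiehler E) (hf : MemH E f) :
    IsHardy (quotient E f) where
  continuousOn := hf.continuousOn_quotient hE
  differentiableOn := hf.boundedType.1.congr fun _ hz =>
    quotient_of_ne_zero hE.entire hf.entire (hE.ne_zero hz)
  memLp := hf.memLp_quotient hE
  exists_sq_norm_mul_im_le := ⟨normH E f ^ 2 / Real.pi, fun z hz => by
    rw [← le_div_iff₀ hz, div_div]
    exact hf.sq_norm_quotient_le hE hz⟩

theorem MemH.norm_le_of_mem_upperHalf (hE : IsHermiteBiehler E) (hf : MemH E f)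
    (hz : z ∈ upperHalf) : ‖f z‖ ≤ ‖E z‖ / √(Real.pi * z.im) * normH E f := by
  have hEz := hE.ne_zero hz
  have hle := hf.sq_norm_quotient_le hE hz
  rw [quotient_of_ne_zero hE.entire hf.entire hEz] at hle
  calc ‖f z‖ = ‖E z‖ * ‖f z / E z‖ := by rw [← norm_mul, mul_div_cancel₀ _ hEz]
    _ ≤ ‖E z‖ * √(normH E f ^ 2 / (Real.pi * z.im)) := by
        gcongr
        exact Real.le_sqrt_of_sq_le hle
    _ = ‖E z‖ / √(Real.pi * z.im) * normH E f := by
        rw [Real.sqrt_div (sq_nonneg _), Real.sqrt_sq (normH_nonneg E f)]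
        ring

end BoundaryExtension

section Kernel

variable {E : ℂ → ℂ}

theorem kernel_eq_dslope (E : ℂ → ℂ) (w : ℝ) (z : ℂ) :
    kernel E w z =
      -dslope (fun ζ => conj (E w) * E ζ - E w * starFn E ζ) w z / (2 * Real.pi * I) := by
  rw [kernel, conj_ofReal]
  split_ifs with h
  · rw [h, dslope_same]
  · rw [dslope_of_ne _ h, slope_def_field, starFn_ofReal, mul_comm (E w) (conj _), sub_self,
      sub_zero, ← neg_sub z, mul_neg, div_neg, neg_div, div_div, mul_comm (z - w)]

theorem kernel_mul_sub (E : ℂ → ℂ) (w : ℝ) (z : ℂ) :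
    kernel E w z * (2 * Real.pi * I * (w - z)) = conj (E w) * E z - E w * starFn E z := by
  have hslope := sub_smul_dslope (fun ζ => conj (E w) * E ζ - E w * starFn E ζ) (w : ℂ) z
  rw [smul_eq_mul, starFn_ofReal, mul_comm (E w) (conj _), sub_self, sub_zero] at hslope
  rw [kernel_eq_dslope, ← mul_assoc, div_mul_cancel₀ _ two_pi_I_ne_zero, ← hslope]
  ring

theorem kernel_eq_div_of_ne (E : ℂ → ℂ) {w : ℝ} {z : ℂ} (hz : z ≠ w) :
    kernel E w z = (conj (E w) * E z - E w * starFn E z) / (2 * Real.pi * I * (w - z)) := by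
  rw [kernel, conj_ofReal, if_neg hz]

theorem differentiable_kernel (hE : Differentiable ℂ E) (w : ℝ) :
    Differentiable ℂ (kernel E w) := by
  have hnum : Differentiable ℂ fun ζ => conj (E w) * E ζ - E w * starFn E ζ :=
    (hE.const_mul _).sub ((differentiable_starFn hE).const_mul _)
  rw [funext (kernel_eq_dslope E w)]
  exact (differentiableOn_univ.1 ((differentiableOn_dslope univ_mem).2
    hnum.differentiableOn)).neg.div_const _

theorem starFn_kernel (hE : Differentiable ℂ E) (w : ℝ) :
    starFn (kernel E w) = kernel E w := by
  have hk := differentiable_kernel hE w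
  refine (differentiable_starFn hk).continuous.ext_on (dense_compl_singleton (w : ℂ))
    hk.continuous fun z hz => ?_
  have hwz : 2 * Real.pi * I * (w - z) ≠ 0 :=
    mul_ne_zero two_pi_I_ne_zero (sub_ne_zero.2 (Ne.symm hz))
  refine mul_right_cancel₀ hwz ?_
  have hconj := congrArg conj (kernel_mul_sub E w (conj z))
  simp only [starFn, map_sub, map_mul, map_ofNat, conj_ofReal, conj_I, conj_conj] at hconj
  rw [kernel_mul_sub, starFn, starFn]
  linear_combination -hconj

theorem norm_starFn_div_ofReal_le (E : ℂ → ℂ) (t : ℝ) : ‖starFn E t / E t‖ ≤ 1 := by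
  rw [norm_div, starFn_ofReal, norm_conj]
  exact div_self_le_one _

theorem norm_kernel_div_mul_le {w : ℝ} {z : ℂ} (hz : ‖starFn E z / E z‖ ≤ 1) :
    ‖kernel E w z / E z‖ * ‖(w : ℂ) - z‖ ≤ ‖E w‖ := by
  have hnum : ‖(conj (E w) * E z - E w * starFn E z) / E z‖ ≤ 2 * ‖E w‖ := by
    rw [sub_div, mul_div_assoc, mul_div_assoc]
    refine (norm_sub_le _ _).trans ?_
    rw [norm_mul, norm_mul, norm_conj, two_mul, norm_div (E z)]
    exact add_le_add (mul_le_of_le_one_right (norm_nonneg _) (div_self_le_one _))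
      (mul_le_of_le_one_right (norm_nonneg _) hz)
  rw [← kernel_mul_sub, mul_div_right_comm, norm_mul, norm_mul, norm_mul, norm_mul, norm_I,
    norm_real, Real.norm_of_nonneg Real.pi_pos.le, norm_ofNat, mul_one] at hnum
  nlinarith [Real.pi_gt_three, norm_nonneg (kernel E w z / E z), norm_nonneg ((w : ℂ) - z),
    mul_nonneg (norm_nonneg (kernel E w z / E z)) (norm_nonneg ((w : ℂ) - z))]

theorem norm_ofReal_sub_ofReal (w t : ℝ) : ‖(w : ℂ) - t‖ = |t - w| := by
  rw [← ofReal_sub, norm_real, Real.norm_eq_abs, abs_sub_comm]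

theorem exists_norm_kernel_div_le (hE : Differentiable ℂ E) {w : ℝ} (hw : E w ≠ 0) :
    ∃ C : ℝ, ∀ t : ℝ, ‖kernel E w t / E t‖ ≤ C := by
  have hcont : ContinuousAt (fun t : ℝ => ‖kernel E w t / E t‖) w :=
    ((((differentiable_kernel hE w).continuous.continuousAt.div hE.continuous.continuousAt
      hw).comp continuous_ofReal.continuousAt)).norm
  obtain ⟨δ, hδ, hball⟩ := Metric.eventually_nhds_iff.1
    (hcont.eventually_lt_const (lt_add_one _))
  refine ⟨max (‖kernel E w w / E w‖ + 1) (‖E w‖ / δ), fun t => ?_⟩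
  rcases lt_or_ge |t - w| δ with ht | ht
  · exact (hball ht).le.trans (le_max_left _ _)
  · refine le_max_of_le_right ((le_div_iff₀ hδ).2 (le_trans ?_
      (norm_kernel_div_mul_le (norm_starFn_div_ofReal_le E t))))
    rw [norm_ofReal_sub_ofReal]
    gcongr

theorem kernel_of_eq_zero {w : ℝ} (hw : E w = 0) (z : ℂ) : kernel E w z = 0 := by
  simp only [kernel, conj_ofReal, hw, map_zero, zero_mul, sub_zero, deriv_const, neg_zero,
    zero_div, ite_self]

theorem integrable_sq_kernel_div (hE : Differentiable ℂ E) (w : ℝ) :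
    Integrable fun t : ℝ => ‖kernel E w t / E t‖ ^ 2 := by
  rcases eq_or_ne (E w) 0 with hw | hw
  · simp [kernel_of_eq_zero hw]
  obtain ⟨C, hC⟩ := exists_norm_kernel_div_le hE hw
  refine ((integrable_inv_sq_add_sq w one_ne_zero).const_mul (‖E w‖ ^ 2 + C ^ 2)).mono'
    ((measurable_div_ofReal hE (differentiable_kernel hE w)).norm.pow_const 2).aestronglyMeasurable
    (Eventually.of_forall fun t => ?_)
  have hfar := norm_kernel_div_mul_le (w := w) (norm_starFn_div_ofReal_le E t)
  rw [norm_ofReal_sub_ofReal] at hfar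
  rw [Real.norm_of_nonneg (sq_nonneg _), ← div_eq_mul_inv, le_div_iff₀ (by positivity), one_pow,
    mul_add, mul_one, ← sq_abs (t - w), ← mul_pow]
  gcongr
  exact hC t

theorem isBoundedAnalytic_inv_add_I : IsBoundedAnalytic fun z => (z + I)⁻¹ := by
  have hle {z : ℂ} (hz : z ∈ upperHalf) : 1 ≤ ‖z + I‖ := by
    have him : 1 ≤ (z + I).im := by
      rw [add_im, I_im]
      exact le_add_of_nonneg_left (le_of_lt hz)
    exact him.trans (im_le_norm _)
  refine ⟨DifferentiableOn.inv (by fun_prop) fun z hz => norm_pos_iff.1 (one_pos.trans_le (hle hz)),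
    1, fun z hz => ?_⟩
  rw [norm_inv]
  exact inv_le_one_of_one_le₀ (hle hz)

theorem isBoundedType_kernel_div (hE : IsHermiteBiehler E) (w : ℝ) :
    IsBoundedType fun z => kernel E w z / E z := by
  have hI_ne {z : ℂ} (hz : z ∈ upperHalf) : z + I ≠ 0 := fun h => by
    have him := congrArg im h
    rw [add_im, I_im, zero_im] at him
    linarith [show 0 < z.im from hz]
  have hdenom {z : ℂ} (hz : z ∈ upperHalf) : -1 + (w + I) * (z + I)⁻¹ = (w - z) * (z + I)⁻¹ := by
    field_simp [hI_ne hz]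
    ring
  have hI : I ∈ upperHalf := by simp [upperHalf]
  have hwI : (w : ℂ) - I ≠ 0 := fun h => by simpa using congrArg im h
  refine ⟨(differentiable_kernel hE.entire w).differentiableOn.div hE.entire.differentiableOn
    fun z hz => hE.ne_zero hz,
    fun z => (2 * Real.pi * I)⁻¹ * ((conj (E w) + -E w * (starFn E z / E z)) * (z + I)⁻¹),
    fun z => -1 + (w + I) * (z + I)⁻¹,
    (IsBoundedAnalytic.const _).mul (((IsBoundedAnalytic.const _).add
      ((IsBoundedAnalytic.const _).mul hE.isBoundedAnalytic_starFn_div)).mul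
        isBoundedAnalytic_inv_add_I),
    (IsBoundedAnalytic.const _).add ((IsBoundedAnalytic.const _).mul isBoundedAnalytic_inv_add_I),
    ⟨I, hI, ?_⟩, fun z hz => ?_⟩
  · beta_reduce
    rw [hdenom hI]
    exact mul_ne_zero hwI (inv_ne_zero (hI_ne hI))
  · have hEz := hE.ne_zero hz
    beta_reduce
    rw [hdenom hz, eq_inv_mul_iff_mul_eq₀ two_pi_I_ne_zero]
    field_simp
    linear_combination (z + I)⁻¹ * kernel_mul_sub E w z

theorem meanType_kernel_div_le_zero (hE : IsHermiteBiehler E) (w : ℝ) :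
    meanType (fun z => kernel E w z / E z) ≤ 0 := by
  rw [meanType_le_zero_iff]
  intro ε hε
  filter_upwards [eventually_const_le_exp ‖E w‖ hε, eventually_ge_atTop 1] with y hexp hy
  have hyU : I * (y : ℂ) ∈ upperHalf := I_mul_mem_upperHalf (one_pos.trans_le hy)
  have hdist : 1 ≤ ‖(w : ℂ) - I * y‖ := by
    have him := abs_im_le_norm ((w : ℂ) - I * y)
    rw [sub_im, ofReal_im, I_mul_im, ofReal_re, zero_sub, abs_neg] at him
    exact hy.trans ((le_abs_self y).trans him)
  exact ((le_mul_of_one_le_right (norm_nonneg _) hdist).trans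
    (norm_kernel_div_mul_le (hE.norm_starFn_div_le hyU))).trans hexp

theorem memH_kernel (hE : IsHermiteBiehler E) (w : ℝ) : MemH E (kernel E w) where
  entire := differentiable_kernel hE.entire w
  sq_integrable := integrable_sq_kernel_div hE.entire w
  boundedType := isBoundedType_kernel_div hE w
  meanType_le := meanType_kernel_div_le_zero hE w
  boundedType_star := by
    simpa only [starFn_kernel hE.entire] using isBoundedType_kernel_div hE w
  meanType_star_le := by
    simpa only [starFn_kernel hE.entire] using meanType_kernel_div_le_zero hE w

end Kernel

section ReproducingProperty

variable {E f G : ℂ → ℂ} {w : ℝ}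

/-- The difference quotient `G z / (z - w)` of a function on the upper half-plane, made regular at
`w` by first subtracting from `G` the multiple of `(z - w + I)⁻¹` that agrees with `G` at `w`. -/
def cauchyQuotient (G : ℂ → ℂ) (w : ℝ) (z : ℂ) : ℂ :=
  (G z - G w * I * (z - (w - I))⁻¹) / (z - w)

theorem IsHardy.cauchyQuotient (hG : IsHardy G) (hGw : DifferentiableAt ℂ G w) :
    Integrable (fun t : ℝ => cauchyQuotient G w t) ∧ ∫ t : ℝ, cauchyQuotient G w t = 0 := by
  have him : ((w : ℂ) - I).im < 0 := by simp
  have hpole : (w : ℂ) - (w - I) ≠ 0 := by simp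
  have hinv : DifferentiableAt ℂ (fun z : ℂ => (z - (w - I))⁻¹) w :=
    DifferentiableAt.fun_inv (by fun_prop) hpole
  have hH := hG.sub (isHardy_const_mul_inv_sub (G w * I) him)
  have hdiff : DifferentiableAt ℂ (fun z => G z - G w * I * (z - (w - I))⁻¹) w :=
    hGw.sub (hinv.const_mul _)
  have hzero : G w - G w * I * ((w : ℂ) - (w - I))⁻¹ = 0 := by
    rw [sub_sub_cancel, mul_inv_cancel_right₀ I_ne_zero, sub_self]
  exact ⟨hH.integrable_div_sub hdiff hzero, hH.integral_div_sub_eq_zero hdiff hzero⟩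

theorem innerH_integrand_eq (E f g : ℂ → ℂ) (t : ℝ) :
    f t * conj (g t) / ((‖E t‖ ^ 2 : ℝ) : ℂ) = f t / E t * conj (g t / E t) := by
  rw [map_div₀, div_mul_div_comm, mul_conj', ofReal_pow]

theorem inv_sub_sub_I_add_inv_sub_add_I (w t : ℝ) : ((t : ℂ) - (w - I))⁻¹ + (t - (w + I))⁻¹ =
    2 * (t - w) * (((t : ℂ) - w) ^ 2 + 1)⁻¹ := by
  have hplus : (t : ℂ) - (w - I) ≠ 0 := ofReal_sub_ne_zero (by simp) t
  have hminus : (t : ℂ) - (w + I) ≠ 0 := ofReal_sub_ne_zero (by simp) t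
  rw [show ((t : ℂ) - w) ^ 2 + 1 = (t - (w - I)) * (t - (w + I)) by linear_combination I_sq]
  field_simp
  ring

theorem MemH.innerH_integrand_kernel_ae_eq (hE : IsHermiteBiehler E) (hf : MemH E f) (w : ℝ) :
    (fun t : ℝ => f t * conj (kernel E w t) / ((‖E t‖ ^ 2 : ℝ) : ℂ)) =ᵐ[volume] fun t : ℝ =>
      (2 * Real.pi * I)⁻¹ * (E w * cauchyQuotient (quotient E f) w t -
        conj (E w) * conj (cauchyQuotient (quotient E (starFn f)) w t) +
          f w * (2 * I) * (((t - w) ^ 2 + 1)⁻¹ : ℝ)) := by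
  filter_upwards [hE.ae_ne_zero, Measure.ae_ne volume w] with t ht htw
  have hquot : E w * cauchyQuotient (quotient E f) w t =
      (E w * (f t / E t) - f w * I * (t - (w - I))⁻¹) / (t - w) := by
    rw [cauchyQuotient, quotient_of_ne_zero hE.entire hf.entire ht, ← hf.quotient_ofReal_mul hE w]
    ring
  have hquot_star : conj (E w) * conj (cauchyQuotient (quotient E (starFn f)) w t) =
      (conj (E w) * (f t / conj (E t)) + f w * I * (t - (w + I))⁻¹) / (t - w) := by
    have hfw : f w = conj (quotient E (starFn f) w) * conj (E w) := by
      rw [← map_mul, hf.star.quotient_ofReal_mul hE w, starFn_ofReal, conj_conj]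
    rw [cauchyQuotient, quotient_of_ne_zero hE.entire hf.star.entire ht, hfw]
    simp only [starFn_ofReal, map_div₀, map_sub, map_mul, map_inv₀, conj_conj, conj_ofReal, conj_I]
    ring
  have htw' : (t : ℂ) - w ≠ 0 := sub_ne_zero.2 (ofReal_injective.ne htw)
  have hwt' : (w : ℂ) - t ≠ 0 := sub_ne_zero.2 (ofReal_injective.ne htw.symm)
  have hEt : conj (E t) ≠ 0 := (map_ne_zero _).2 ht
  rw [hquot, hquot_star, innerH_integrand_eq, kernel_eq_div_of_ne E (ofReal_injective.ne htw)]
  push_cast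
  rw [eq_inv_mul_iff_mul_eq₀ two_pi_I_ne_zero, ← sub_div, ← mul_left_inj' htw', add_mul,
    div_mul_cancel₀ _ htw']
  simp only [starFn_ofReal, map_div₀, map_sub, map_mul, conj_conj, conj_ofReal, conj_I, map_ofNat]
  have hcancel : 2 * Real.pi * I * (f t / E t * ((E w * conj (E t) - conj (E w) * E t) /
      (2 * Real.pi * -I * (w - t)) / conj (E t))) * (t - w) =
      E w * (f t / E t) - conj (E w) * (f t / conj (E t)) := by
    field_simp
    ring
  linear_combination hcancel + f w * I * inv_sub_sub_I_add_inv_sub_add_I w t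

theorem MemH.innerH_kernel (hE : IsHermiteBiehler E) (hf : MemH E f) (w : ℝ) :
    innerH E f (kernel E w) = f w := by
  obtain ⟨hi, hint⟩ := (hf.isHardy_quotient hE).cauchyQuotient
    (hf.analyticAt_quotient_ofReal hE w).differentiableAt
  obtain ⟨hi_star, hint_star⟩ := (hf.star.isHardy_quotient hE).cauchyQuotient
    (hf.star.analyticAt_quotient_ofReal hE w).differentiableAt
  have hi_conj : Integrable fun t : ℝ => conj (cauchyQuotient (quotient E (starFn f)) w t) :=
    conjCLE.integrable_comp_iff.2 hi_star
  have hi_diff : Integrable fun t : ℝ => E w * cauchyQuotient (quotient E f) w t -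
      conj (E w) * conj (cauchyQuotient (quotient E (starFn f)) w t) :=
    (hi.const_mul _).sub (hi_conj.const_mul _)
  have hi_poisson : Integrable fun t : ℝ => ((((t - w) ^ 2 + 1)⁻¹ : ℝ) : ℂ) := by
    simpa only [one_pow] using! (integrable_inv_sq_add_sq w one_ne_zero).ofReal (𝕜 := ℂ)
  rw [innerH, integral_congr_ae (hf.innerH_integrand_kernel_ae_eq hE w), integral_const_mul,
    integral_add hi_diff (hi_poisson.const_mul _),
    integral_sub (hi.const_mul _) (hi_conj.const_mul _), integral_const_mul, integral_const_mul,
    integral_const_mul, integral_conj, hint, hint_star, integral_complex_ofReal,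
    integral_inv_sq_add_one, inv_mul_eq_iff_eq_mul₀ two_pi_I_ne_zero, map_zero]
  ring

end ReproducingProperty

section Space

variable {ι : Type*} {E F : ℂ → ℂ}

theorem memH_zero (hE : IsHermiteBiehler E) : MemH E 0 := by
  simpa only [zero_mul] using! (memH_kernel hE 0).const_mul 0

/-- The vector space underlying `H(E)`; its inner product is that of `L²(ℝ)` along `toL2`. -/
def space (hE : IsHermiteBiehler E) : Submodule ℂ (ℂ → ℂ) where
  carrier := {f | MemH E f}
  add_mem' hf hg := hf.add hE hg
  zero_mem' := memH_zero hE
  smul_mem' c _ hf := hf.const_mul c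

/-- The isometric embedding `f ↦ f / E` of `H(E)` into `L²(ℝ)`. -/
def toL2 (hE : IsHermiteBiehler E) : space hE →ₗ[ℂ] Lp ℂ 2 (volume : Measure ℝ) where
  toFun f := (f.2.memLp hE).toLp _
  map_add' f g := by
    rw [← MemLp.toLp_add]
    exact MemLp.toLp_congr _ _ (Eventually.of_forall fun t => add_div _ _ _)
  map_smul' c f := by
    rw [RingHom.id_apply, ← MemLp.toLp_const_smul]
    exact MemLp.toLp_congr _ _ (Eventually.of_forall fun t => mul_div_assoc _ _ _)

theorem coeFn_toL2 (hE : IsHermiteBiehler E) (f : space hE) :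
    toL2 hE f =ᵐ[volume] fun t : ℝ => (f : ℂ → ℂ) t / E t :=
  (f.2.memLp hE).coeFn_toLp

theorem inner_toL2 (hE : IsHermiteBiehler E) (f g : space hE) :
    inner ℂ (toL2 hE g) (toL2 hE f) = innerH E f g := by
  rw [L2.inner_def, innerH]
  refine integral_congr_ae ?_
  filter_upwards [coeFn_toL2 hE f, coeFn_toL2 hE g] with t hf hg
  rw [hf, hg, innerH_integrand_eq, RCLike.inner_apply]

theorem norm_toL2 (hE : IsHermiteBiehler E) (f : space hE) : ‖toL2 hE f‖ = normH E f := by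
  have hinner : innerH E f f = ((normH E f ^ 2 : ℝ) : ℂ) := by
    rw [normH_sq, innerH, ← integral_complex_ofReal]
    exact integral_congr_ae (Eventually.of_forall fun t => by
      beta_reduce
      rw [innerH_integrand_eq, mul_conj', ofReal_pow])
  have hsq : ‖toL2 hE f‖ ^ 2 = normH E f ^ 2 := by
    rw [← ofReal_inj, ← hinner, ← inner_toL2 hE, inner_self_eq_norm_sq_to_K, ofReal_pow]
    rfl
  exact (sq_eq_sq₀ (norm_nonneg _) (normH_nonneg _ _)).1 hsq

theorem coe_sub_sum {hE : IsHermiteBiehler E} (f : space hE) (u : ι → space hE) (c : ι → ℂ)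
    (s : Finset ι) :
    ((f - ∑ n ∈ s, c n • u n : space hE) : ℂ → ℂ) =
      fun z => (f : ℂ → ℂ) z - ∑ n ∈ s, c n * (u n : ℂ → ℂ) z := by
  funext z
  simp

theorem normH_sub_sum (hE : IsHermiteBiehler E) (f : space hE) (u : ι → space hE) (c : ι → ℂ)
    (s : Finset ι) :
    normH E (fun z => (f : ℂ → ℂ) z - ∑ n ∈ s, c n * (u n : ℂ → ℂ) z) =
      ‖toL2 hE f - ∑ n ∈ s, c n • toL2 hE (u n)‖ := by
  simp only [← coe_sub_sum, ← norm_toL2 hE, map_sub, map_sum, map_smul]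

theorem IsCompleteIn.toL2_mem_closure_span {hE : IsHermiteBiehler E} {u : ι → space hE}
    (hu : IsCompleteIn E fun n => (u n : ℂ → ℂ)) (f : space hE) :
    toL2 hE f ∈ (span ℂ (Set.range fun n => toL2 hE (u n))).topologicalClosure := by
  refine Metric.mem_closure_iff.2 fun ε hε => ?_
  obtain ⟨s, c, hs⟩ := hu f f.2 ε hε
  refine ⟨∑ n ∈ s, c n • toL2 hE (u n),
    sum_smul_mem _ c fun n _ => subset_span (Set.mem_range_self n), ?_⟩
  rwa [dist_eq_norm, ← normH_sub_sum]

theorem toL2_mul_left (hE : IsHermiteBiehler E) (hF : IsHermiteBiehler F) (f : space hE) :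
    toL2 (hE.mul hF) ⟨fun z => F z * (f : ℂ → ℂ) z, f.2.mul_left hF⟩ = toL2 hE f := by
  refine MemLp.toLp_congr ((f.2.mul_left hF).memLp (hE.mul hF)) (f.2.memLp hE) ?_
  filter_upwards [hF.ae_ne_zero] with t ht
  rw [mul_comm (F t), mul_div_mul_right _ _ ht]

/-- The reproducing kernel at a real point, as an element of the space. -/
def kernelAt (hE : IsHermiteBiehler E) (w : ℝ) : space hE := ⟨kernel E w, memH_kernel hE w⟩

theorem inner_kernelAt (hE : IsHermiteBiehler E) (w : ℝ) (f : space hE) :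
    inner ℂ (toL2 hE (kernelAt hE w)) (toL2 hE f) = (f : ℂ → ℂ) w := by
  rw [inner_toL2]
  exact f.2.innerH_kernel hE w

theorem inner_kernelAt_mul (hE : IsHermiteBiehler E) (hF : IsHermiteBiehler F) (w : ℝ)
    (f : space hE) :
    inner ℂ (toL2 (hE.mul hF) (kernelAt (hE.mul hF) w)) (toL2 hE f) = F w * (f : ℂ → ℂ) w := by
  rw [← toL2_mul_left hE hF, inner_kernelAt]

theorem kernel_self (hE : IsHermiteBiehler E) (w : ℝ) :
    kernel E w w = ((‖toL2 hE (kernelAt hE w)‖ ^ 2 : ℝ) : ℂ) := by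
  rw [ofReal_pow]
  exact (inner_kernelAt hE w (kernelAt hE w)).symm.trans (inner_self_eq_norm_sq_to_K _)

theorem exists_norm_apply_le (hE : IsHermiteBiehler E) (z : ℂ) :
    ∃ C : ℝ, ∀ f, MemH E f → ‖f z‖ ≤ C * normH E f := by
  rcases lt_trichotomy z.im 0 with hz | hz | hz
  · have hz_conj : conj z ∈ upperHalf := neg_pos.2 hz
    refine ⟨‖E (conj z)‖ / √(Real.pi * (conj z).im), fun f hf => ?_⟩
    have hstar := hf.star.norm_le_of_mem_upperHalf hE hz_conj
    rwa [normH_starFn, starFn, conj_conj, norm_conj] at hstar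
  · obtain ⟨x, rfl⟩ : ∃ x : ℝ, (x : ℂ) = z := ⟨z.re, Complex.ext rfl hz.symm⟩
    refine ⟨‖toL2 hE (kernelAt hE x)‖, fun f hf => ?_⟩
    have hCS := norm_inner_le_norm (𝕜 := ℂ) (toL2 hE (kernelAt hE x)) (toL2 hE ⟨f, hf⟩)
    rwa [inner_kernelAt, norm_toL2 hE ⟨f, hf⟩] at hCS
  · exact ⟨_, fun f hf => hf.norm_le_of_mem_upperHalf hE hz⟩

theorem isExpansion_of_hasSum (hE : IsHermiteBiehler E) {f : space hE} {u : ι → space hE}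
    {c : ι → ℂ} (h : HasSum (fun n => c n • toL2 hE (u n)) (toL2 hE f)) :
    IsExpansion E f fun n z => c n * (u n : ℂ → ℂ) z := by
  have hnorm : Tendsto (fun s : Finset ι =>
      normH E fun z => (f : ℂ → ℂ) z - ∑ n ∈ s, c n * (u n : ℂ → ℂ) z) atTop (𝓝 0) := by
    simp only [normH_sub_sum, norm_sub_rev (toL2 hE f)]
    exact tendsto_iff_norm_sub_tendsto_zero.1 h
  refine ⟨hnorm, fun z => ?_⟩
  obtain ⟨C, hC⟩ := exists_norm_apply_le hE z
  have hbound (s : Finset ι) : ‖∑ n ∈ s, c n * (u n : ℂ → ℂ) z - (f : ℂ → ℂ) z‖ ≤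
      C * normH E fun z => (f : ℂ → ℂ) z - ∑ n ∈ s, c n * (u n : ℂ → ℂ) z := by
    rw [norm_sub_rev]
    exact hC _ (coe_sub_sum f u c s ▸ (f - ∑ n ∈ s, c n • u n).2)
  have hlim := hnorm.const_mul C
  rw [mul_zero] at hlim
  have hpointwise := squeeze_zero (fun s => norm_nonneg _) hbound hlim
  simpa only [HasSum, SummationFilter.unconditional_filter] using
    tendsto_iff_norm_sub_tendsto_zero.2 hpointwise

end Space

section Expansion

variable {ι : Type*} {E F : ℂ → ℂ} {lam : ι → ℝ}

theorem IsPhaseFunction.conj_eq {φ : ℝ → ℝ} (hφ : IsPhaseFunction E φ) (x : ℝ) :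
    conj (E x) = E x * exp (2 * φ x * I) := by
  have hreal := conj_eq_iff_im.2 (hφ.real x)
  have hconj : conj (exp (I * φ x)) = (exp (I * φ x))⁻¹ := by
    rw [← exp_conj, ← exp_neg, map_mul, conj_I, conj_ofReal, neg_mul]
  rw [map_mul, hconj, mul_inv_eq_iff_eq_mul₀ (exp_ne_zero _), mul_assoc, ← exp_add] at hreal
  rw [hreal]
  ring_nf

theorem IsPhaseFunction.kernel_eq_zero {φ : ℝ → ℝ} (hφ : IsPhaseFunction E φ) {x y : ℝ}
    (hxy : x ≠ y) {k : ℤ} (h : φ x = φ y + k * Real.pi) : kernel E x y = 0 := by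
  have hexp : exp (2 * φ x * I) = exp (2 * φ y * I) := by
    refine exp_eq_exp_iff_exists_int.2 ⟨k, ?_⟩
    rw [h, ofReal_add, ofReal_mul, ofReal_intCast]
    ring
  rw [kernel_eq_div_of_ne E (ofReal_injective.ne hxy.symm), starFn, conj_ofReal, hφ.conj_eq,
    hφ.conj_eq, hexp, div_eq_zero_iff]
  left
  ring

theorem IsPhaseFunction.pairwise_kernel_eq_zero {φ : ℝ → ℝ} (hφ : IsPhaseFunction E φ)
    {k : ι → ℤ} (hk : k.Injective) {α : ℝ} (hlam : ∀ n, φ (lam n) = k n * Real.pi + α) :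
    Pairwise fun m n => kernel E (lam m) (lam n) = 0 := by
  intro m n hmn
  refine hφ.kernel_eq_zero (k := k m - k n) (fun h => hmn (hk ?_)) ?_
  · have hphase := hlam m
    rw [h, hlam n, add_left_inj, mul_left_inj' Real.pi_ne_zero, Int.cast_inj] at hphase
    exact hphase.symm
  · rw [hlam m, hlam n, Int.cast_sub]
    ring

theorem pairwise_inner_kernelAt_eq_zero (hE : IsHermiteBiehler E)
    (horth : Pairwise fun m n => kernel E (lam m) (lam n) = 0) :
    Pairwise fun m n =>
      inner ℂ (toL2 hE (kernelAt hE (lam m))) (toL2 hE (kernelAt hE (lam n))) = 0 :=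
  fun m _ hmn => (inner_kernelAt hE (lam m) _).trans (horth hmn.symm)

theorem toL2_mem_closure_span_kernelAt_mul (hE : IsHermiteBiehler E) (hF : IsHermiteBiehler F)
    (hc : IsCompleteIn (fun z => E z * F z) fun n z => kernel (fun z => E z * F z) (lam n) z)
    (f : space hE) :
    toL2 hE f ∈ (span ℂ (Set.range fun n =>
      toL2 (hE.mul hF) (kernelAt (hE.mul hF) (lam n)))).topologicalClosure := by
  rw [← toL2_mul_left hE hF]
  exact IsCompleteIn.toL2_mem_closure_span (u := fun n => kernelAt (hE.mul hF) (lam n)) hc _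

theorem isParsevalFrame_kernel (hE : IsHermiteBiehler E) (hF : IsHermiteBiehler F)
    (horth : Pairwise fun m n => kernel (fun z => E z * F z) (lam m) (lam n) = 0)
    (hc : IsCompleteIn (fun z => E z * F z) fun n z => kernel (fun z => E z * F z) (lam n) z)
    {a : ι → ℂ} (ha : ∀ n, ‖a n‖ = ‖F (lam n)‖) :
    IsParsevalFrame E fun n z => a n * kernel E (lam n) z /
      (√(kernel (fun z => E z * F z) (lam n) (lam n)).re : ℂ) := by
  have hEF := hE.mul hF
  simp only [mul_div_right_comm, kernel_self hEF, ofReal_re, Real.sqrt_sq (norm_nonneg _)]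
  refine ⟨fun n => (memH_kernel hE _).const_mul _, fun f hf => ?_⟩
  have hsum := hasSum_sq_norm_inner_div (pairwise_inner_kernelAt_eq_zero hEF horth)
    (toL2_mem_closure_span_kernelAt_mul hE hF hc ⟨f, hf⟩)
  rw [norm_toL2 hE ⟨f, hf⟩] at hsum
  refine hsum.congr_fun fun n => ?_
  have hinner := inner_toL2 hE ⟨f, hf⟩
    ((a n / ‖toL2 hEF (kernelAt hEF (lam n))‖ : ℂ) • kernelAt hE (lam n))
  rw [map_smul, inner_smul_left, inner_kernelAt] at hinner
  rw [inner_kernelAt_mul hE hF, norm_mul, ← ha, mul_pow, mul_div_right_comm, ← div_pow]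
  refine (congrArg (‖·‖ ^ 2) hinner.symm).trans ?_
  rw [norm_mul, norm_conj, norm_div, norm_real, norm_norm, mul_pow]

theorem isExpansion_kernel (hE : IsHermiteBiehler E) (hF : IsHermiteBiehler F)
    (horth : Pairwise fun m n => kernel (fun z => E z * F z) (lam m) (lam n) = 0)
    (hc : IsCompleteIn (fun z => E z * F z) fun n z => kernel (fun z => E z * F z) (lam n) z)
    {f : ℂ → ℂ} (hf : MemH E f) :
    IsExpansion E f fun n z => f (lam n) * ((‖F (lam n)‖ ^ 2 : ℝ) * kernel E (lam n) z /
      kernel (fun z => E z * F z) (lam n) (lam n)) := by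
  have hEF := hE.mul hF
  have hsum := hasSum_orthogonal_expansion (pairwise_inner_kernelAt_eq_zero hEF horth)
    (toL2_mem_closure_span_kernelAt_mul hE hF hc ⟨f, hf⟩)
  simp only [inner_kernelAt_mul hE hF, RCLike.ofReal_eq_complex_ofReal, ← kernel_self hEF] at hsum
  have hproj := hasSum_smul_of_inner_eq_inner (W := LinearMap.range (toL2 hE))
    (v := fun n => toL2 hE (conj (F (lam n)) • kernelAt hE (lam n)))
    ⟨⟨f, hf⟩, rfl⟩ (fun n => ⟨_, rfl⟩) ?_ hsum
  · convert isExpansion_of_hasSum hE hproj using 3 with n z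
    rw [Submodule.coe_smul, Pi.smul_apply, smul_eq_mul, ofReal_pow, ← mul_conj',
      kernelAt]
    ring
  · rintro n _ ⟨g, rfl⟩
    rw [map_smul, inner_smul_right, ← inner_conj_symm, inner_kernelAt,
      ← inner_conj_symm, inner_kernelAt_mul hE hF, map_mul]

end Expansion

end

end DeBranges

open DeBranges in
theorem theoremT_general {ι : Type*} {E F : ℂ → ℂ} {lam : ι → ℝ}
    (hE : IsHermiteBiehler E) (hF : IsHermiteBiehler F)
    (horth : Pairwise fun m n => kernel (fun z => E z * F z) (lam m) (lam n) = 0)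
    (hcomplete : IsCompleteIn (fun z => E z * F z)
      fun n z => kernel (fun z => E z * F z) (lam n) z) :
    IsParsevalFrame E (fun n z =>
        conj (F (lam n)) * kernel E (lam n) z /
          (√(kernel (fun z => E z * F z) (lam n) (lam n)).re : ℂ)) ∧
      (∀ f, MemH E f → IsExpansion E f fun n z =>
        f (lam n) * ((‖F (lam n)‖ ^ 2 : ℝ) * kernel E (lam n) z /
          kernel (fun z => E z * F z) (lam n) (lam n))) ∧
      IsParsevalFrame F (fun n z =>
        E (lam n) * kernel F (lam n) z /
          (√(kernel (fun z => E z * F z) (lam n) (lam n)).re : ℂ)) ∧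
      (∀ g, MemH F g → IsExpansion F g fun n z =>
        g (lam n) * ((‖E (lam n)‖ ^ 2 : ℝ) * kernel F (lam n) z /
          kernel (fun z => E z * F z) (lam n) (lam n))) := by
  refine ⟨isParsevalFrame_kernel hE hF horth hcomplete fun n => norm_conj _,
    fun f hf => isExpansion_kernel hE hF horth hcomplete hf, ?_⟩
  have hcomm : (fun z => E z * F z) = fun z => F z * E z := funext fun z => mul_comm _ _
  rw [hcomm] at horth hcomplete ⊢
  exact ⟨isParsevalFrame_kernel hF hE horth hcomplete fun n => rfl,
    fun g hg => isExpansion_kernel hF hE horth hcomplete hg⟩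

open DeBranges Complex in
open scoped ComplexConjugate in
theorem theoremT (E F : ℂ → ℂ) (hE : IsHermiteBiehler E) (hF : IsHermiteBiehler F)
    (φ : ℝ → ℝ) (hφ : IsPhaseFunction (fun z => E z * F z) φ)
    (α : ℝ) (hα : α ∈ Set.Ico 0 Real.pi)
    (J : Set ℤ) (lam : J → ℝ) (hlam : ∀ n : J, φ (lam n) = ((n : ℤ) : ℝ) * Real.pi + α)
    (hcomplete : IsCompleteIn (fun z => E z * F z)
      (fun (n : J) z => kernel (fun z => E z * F z) (lam n) z)) :
    IsParsevalFrame E (fun (n : J) z =>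
        conj (F (lam n)) * kernel E (lam n) z /
          (Real.sqrt (kernel (fun z => E z * F z) (lam n) (lam n)).re : ℂ)) ∧
      (∀ f, MemH E f → IsExpansion E f (fun (n : J) z =>
        f (lam n) * ((‖F (lam n)‖ ^ 2 : ℝ) * kernel E (lam n) z /
          kernel (fun z => E z * F z) (lam n) (lam n)))) ∧
      IsParsevalFrame F (fun (n : J) z =>
        E (lam n) * kernel F (lam n) z /
          (Real.sqrt (kernel (fun z => E z * F z) (lam n) (lam n)).re : ℂ)) ∧
      (∀ g, MemH F g → IsExpansion F g (fun (n : J) z =>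
        g (lam n) * ((‖E (lam n)‖ ^ 2 : ℝ) * kernel F (lam n) z /
          kernel (fun z => E z * F z) (lam n) (lam n)))) :=
  theoremT_general hE hF (hφ.pairwise_kernel_eq_zero Subtype.val_injective hlam) hcomplete
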